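/- Let $\mathbb K$ be a field. For $k,n\ge 1$ let $\operatorname{NCP}(k,n)$ be the set of noncrossing partitions of $[n]=\{1,\dots,n\}$ with $k$ blocks, and let $\operatorname{NCP}=\bigsqcup_{k,n\geq 1}\operatorname{NCP}(k,n)$. A noncrossing partition of a finite linearly ordered set is identified with its standardization on some $[n]$; $P_{|X}$ denotes the restriction of $P$ to $X$, and $P\le Q$ means that $P$ is finer than $Q$. The ordinal sum of partitions of $[m]$ and $[n]$ is the partition of $[m+n]$ they induce on the first $m$ and the last $n$ elements. A $P\in\operatorname{NCP}$ is irreducible if it is not an ordinal sum of two non-empty partitions, and boolean if it is an iterated ordinal sum of one-block partitions. **The algebra $H$.** Let $H$ be the free associative algebra on $\operatorname{NCP}$, the empty partition being identified with $1$. An upperset $U$ of $P$ is a set of blocks such that, if $\pi\in U$ and a block $\rho$ meets the convex hull $[\min\pi,\max\pi]$, then $\rho\in U$; its complement $L$ is a lowerset, and $(L,U)$ is called a cut of $P$. Let $\overline U\in H$ be the product, from left to right, of the restrictions of $P$ to the non-empty maximal intervals of $[n]$ between consecutive points of $\bigcup L$ (before the first and after the last one included). Cuts of a monomial $P_1\cdots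 P_r$ are tuples of cuts of the factors, with the products of the corresponding $L$'s and of the corresponding $\overline U$'s. For a monomial $P\ne 1$ put $$\Delta_\prec(P)=\sum_{(L,U),\,1\in L}L\otimes\overline U,\qquad \Delta_\succ(P)=\sum_{(L,U),\,1\in U}L\otimes\overline U,$$ the sums being over the cuts of $P$, where $1$ denotes the first element of the first factor. For linear forms $f,g$ on $H$ let $f\prec g$ and $f\succ g$ be the linear forms that vanish at $1\in H$ and are equal to $(f\otimes g)\circ\Delta_\prec$, resp. $(f\otimes g)\circ\Delta_\succ$, on monomials $\neq1$. Let $\varepsilon_H$ be the algebra morphism $H\to\mathbb K$ that vanishes on $\operatorname{NCP}$, and let $e$ be the linear form on $H$ that vanishes on $1$ and on all products of two or more elements of $\operatorname{NCP}$, with $e(P)=\delta_{k,1}$ for $P\in\operatorname{NCP}(k,n)$. **The algebra $B$.** Let $B$ be the free commutative algebra on $\operatorname{NCP}$. The convolution of two characters (algebra morphisms $B\to\mathbb K$) is the character given on $P\in \operatorname{NCP}$ by $$(\phi*\psi)(P)=\sum_{Q\ge P}\phi(Q)\prod_{\tau\text{ block of }Q}\psi(P_{|\tau}),$$ the sum being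 over noncrossing $Q$; its unit $\varepsilon_B$ is given by $\varepsilon_B(P)=\delta_{k,1}$ for $P\in\operatorname{NCP}(k,n)$. Characters of $H$ are identified with the characters of $B$ that have the same values on $\operatorname{NCP}$. **Proposition.** The equation $\phi=\varepsilon_H+e\prec\phi$ has a unique solution $\psi_\prec$ among the linear forms on $H$, the equation $\phi=\varepsilon_H+\phi\succ e$ has a unique solution $\psi_\succ$, and both are characters of $H$. As characters of $B$ they have unique two-sided inverses $\psi_\prec^{*-1}$ and $\psi_\succ^{*-1}$ for $*$. For all $k,n\ge1$ and all $P\in\operatorname{NCP}(k,n)$: $$\psi_\succ^{*-1}(P)=\begin{cases}(-1)^{k+1}&\text{if }P\text{ is boolean},\\0&\text{otherwise};\end{cases}$$ $$(\psi_\succ^{*-1}*\psi_\prec)(P)=\begin{cases}1&\text{if }P\text{ is irreducible},\\0&\text{otherwise};\end{cases}$$ $$(\psi_\prec^{*-1}*\psi_\succ)(P)=\begin{cases}(-1)^{k+1}&\text{if }P\text{ is irreducible},\\0&\text{otherwise}.\end{cases}$$ -/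

import Mathlib

open scoped TensorProduct Classical

noncomputable section

/-! ## Noncrossing partitions -/

/-- A partition, given as an equivalence relation on a linear order, is noncrossing if there are no
`a < c < b < d` with `a, b` in one block and `c, d` in a different block. -/
def Noncrossing {α : Type*} [LinearOrder α] (P : Setoid α) : Prop :=
  ∀ a b c d : α, a < c → c < b → b < d → P a b → P c d → P a c

/-- Noncrossing partitions of the standard linear order with `n` elements (`0, …, n - 1`). -/
@[ext]
structure NCPart (n : ℕ) where
  rel : Setoid (Fin n)
  nc : Noncrossing rel

namespace NCPart

variable {n : ℕ}

/-- `P ≤ Q` means that `P` is finer than `Q`. -/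
instance : LE (NCPart n) := ⟨fun P Q => P.rel ≤ Q.rel⟩

instance : Finite (NCPart n) :=
  Finite.of_injective (fun P : NCPart n => fun a b : Fin n => P.rel a b) (by
    intro P Q h
    ext a b
    exact iff_of_eq (congrFun (congrFun h a) b))

instance : Fintype (NCPart n) := Fintype.ofFinite _

/-- The set of blocks of a partition. -/
abbrev Blocks (P : NCPart n) : Type := Quotient P.rel

/-- The underlying set of a block. -/
def block (P : NCPart n) (q : P.Blocks) : Finset (Fin n) :=
  Finset.univ.filter fun i => (Quotient.mk P.rel i) = q

theorem block_nonempty (P : NCPart n) (q : P.Blocks) : (P.block q).Nonempty := by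
  induction q using Quotient.inductionOn with
  | h i => exact ⟨i, by simp [block]⟩

/-- The restriction `P_{|X}`, transported to the standard linear order along the unique
monotone bijection. -/
def restrict (P : NCPart n) (X : Finset (Fin n)) : NCPart X.card where
  rel := P.rel.comap (X.orderEmbOfFin rfl)
  nc := fun _ _ _ _ hac hcb hbd hab hcd =>
    P.nc _ _ _ _ ((X.orderEmbOfFin rfl).strictMono hac) ((X.orderEmbOfFin rfl).strictMono hcb)
      ((X.orderEmbOfFin rfl).strictMono hbd) hab hcd

/-- `U`, given by its underlying set of points, is an upperset of `P`: it is a union of blocks,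
and if a block `π` is in `U` then so is each block that meets the convex hull of `π`. -/
def IsUpperset (P : NCPart n) (U : Finset (Fin n)) : Prop :=
  (∀ a b, P.rel a b → a ∈ U → b ∈ U) ∧
    ∀ a b x, a ∈ U → P.rel a b → a ≤ x → x ≤ b → x ∈ U

/-- The coarsest partition `I_n`, with a single block. -/
def coarsest (n : ℕ) : NCPart n := ⟨⊤, fun _ _ _ _ _ _ _ _ _ => trivial⟩

/-- The ordinal sum of two partitions: `Fin (m + n)` is cut into its first `m` and its last `n`
elements, which are partitioned by `A` and by `B`. -/
def ordSum {m n : ℕ} (A : NCPart m) (B : NCPart n) : NCPart (m + n) where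
  rel :=
    { r := fun x y =>
        (∃ i j, A.rel i j ∧ x = Fin.castAdd n i ∧ y = Fin.castAdd n j) ∨
        (∃ i j, B.rel i j ∧ x = Fin.natAdd m i ∧ y = Fin.natAdd m j)
      iseqv :=
        { refl := fun x => by
            induction x using Fin.addCases with
            | left i => exact Or.inl ⟨i, i, A.rel.refl i, rfl, rfl⟩
            | right i => exact Or.inr ⟨i, i, B.rel.refl i, rfl, rfl⟩
          symm := by
            rintro x y (⟨i, j, h, hx, hy⟩ | ⟨i, j, h, hx, hy⟩)
            · exact Or.inl ⟨j, i, A.rel.symm h, hy, hx⟩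
            · exact Or.inr ⟨j, i, B.rel.symm h, hy, hx⟩
          trans := by
            rintro x y z (⟨i, j, h, hx, hy⟩ | ⟨i, j, h, hx, hy⟩)
              (⟨i', j', h', hx', hy'⟩ | ⟨i', j', h', hx', hy'⟩)
            · obtain rfl : j = i' := by
                have := congrArg Fin.val (hy.symm.trans hx')
                exact Fin.ext (by simpa using this)
              exact Or.inl ⟨i, j', A.rel.trans h h', hx, hy'⟩
            · have := congrArg Fin.val (hy.symm.trans hx')
              simp at this; omega
            · have := congrArg Fin.val (hy.symm.trans hx')
              simp at this; omega
            · obtain rfl : j = i' := by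
                have := congrArg Fin.val (hy.symm.trans hx')
                exact Fin.ext (by simpa using this)
              exact Or.inr ⟨i, j', B.rel.trans h h', hx, hy'⟩ } }
  nc := by
    rintro a b c d hac hcb hbd (⟨i, j, h, rfl, rfl⟩ | ⟨i, j, h, rfl, rfl⟩)
      (⟨i', j', h', rfl, rfl⟩ | ⟨i', j', h', rfl, rfl⟩)
    · exact Or.inl ⟨i, i', A.nc i j i' j' hac hcb hbd h h', rfl, rfl⟩
    · simp only [Fin.lt_def, Fin.val_castAdd, Fin.val_natAdd] at hac hcb hbd; omega
    · simp only [Fin.lt_def, Fin.val_castAdd, Fin.val_natAdd] at hac hcb hbd; omega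
    · exact Or.inr ⟨i, i', B.nc i j i' j' (by simpa using hac) (by simpa using hcb)
        (by simpa using hbd) h h', rfl, rfl⟩

/-- The gap number `i` of a set `L = {x_1 < ⋯ < x_k}` is `{y | x_i < y < x_{i+1}}` (with
`x_0 = -∞`, `x_{k+1} = ∞`): the `y ∉ L` with exactly `i` elements of `L` below them. -/
def gap (L : Finset (Fin n)) (i : ℕ) : Finset (Fin n) :=
  Finset.univ.filter fun y => y ∉ L ∧ (L.filter (· < y)).card = i

end NCPart

/-- The set `NCP` of all non-empty noncrossing partitions. -/
structure NCP where
  deg : ℕ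
  pos : 0 < deg
  part : NCPart deg

namespace NCP

/-- The number `k` of blocks of `P ∈ NCP(k, n)`. -/
def numBlocks (P : NCP) : ℕ := Nat.card P.part.Blocks

/-- The standardized restriction of `P` to a non-empty subset. -/
def restrict (P : NCP) (X : Finset (Fin P.deg)) (hX : X.Nonempty) : NCP :=
  ⟨X.card, hX.card_pos, P.part.restrict X⟩

/-- The smallest element of the underlying linear order (denoted `1` when it is `{1, …, n}`). -/
def first (P : NCP) : Fin P.deg := ⟨0, P.pos⟩

/-- The one-block partition `I_n`, `n ≥ 1`. -/
def coarsest (n : ℕ) (hn : 0 < n) : NCP := ⟨n, hn, NCPart.coarsest n⟩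

/-- Ordinal sum of non-empty noncrossing partitions. -/
def ordSum (A B : NCP) : NCP := ⟨A.deg + B.deg, Nat.add_pos_left A.pos _, A.part.ordSum B.part⟩

/-- `P` is not the ordinal sum of two non-empty partitions. -/
def IsIrreducible (P : NCP) : Prop := ¬ ∃ A B : NCP, P = A.ordSum B

/-- `P` is an iterated ordinal sum of (at least one) one-block partitions. -/
inductive IsBoolean : NCP → Prop
  | coarsest (n : ℕ) (hn : 0 < n) : IsBoolean (NCP.coarsest n hn)
  | ordSum (A B : NCP) : IsBoolean A → IsBoolean B → IsBoolean (A.ordSum B)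

end NCP

/-! ## The gap-insertion Hopf algebra and its half-unshuffles -/

variable (K : Type*) [Field K]

/-- The algebra `H` freely generated by `NCP`; the monomials `P₁ ⋯ P_r` are a basis. -/
abbrev HGap : Type _ := FreeAlgebra K NCP

namespace HGap

/-- The class in `H` of the restriction of `P` to `X`; the empty partition is the unit of `H`. -/
def ofRestrict (P : NCP) (X : Finset (Fin P.deg)) : HGap K :=
  if hX : X.Nonempty then FreeAlgebra.ι K (P.restrict X hX) else 1

/-- The reduced gap monomial of an upperset `U` of `P`: the ordered product of the restrictions of
`P` to the gaps (numbered `0, …, k`) of the complement of `U`, `k` being its number of points. -/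
def gapMonomial (P : NCP) (U : Finset (Fin P.deg)) : HGap K :=
  ((List.range (Uᶜ.card + 1)).map fun i => ofRestrict K P (NCPart.gap Uᶜ i)).prod

/-- The term `L ⊗ (reduced gap monomial of U)` of the cut `(L, U)` of `P`, `L` being the
complement of `U`. -/
def cutTerm (P : NCP) (U : Finset (Fin P.deg)) : HGap K ⊗[K] HGap K :=
  ofRestrict K P Uᶜ ⊗ₜ[K] gapMonomial K P U

/-- The coproduct `Δ` of `H`: the multiplicative extension of the sum over all cuts. -/
def Δ : HGap K →ₐ[K] HGap K ⊗[K] HGap K :=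
  FreeAlgebra.lift K fun P =>
    ∑ U ∈ Finset.univ.filter (fun U => P.part.IsUpperset U), cutTerm K P U

/-- The counit of `H`. -/
def ε : HGap K →ₐ[K] K := FreeAlgebra.lift K fun _ => 0

/-- The sum of the `L ⊗ (reduced gap monomial of U)` over the cuts `(L, U)` of a multipartition
`P₁ ⋯ P_r`, `r ≥ 1`, whose lowerset `L` contains the first element. A cut of `P₁ ⋯ P_r` is a tuple of
cuts of the `P_i`, the terms are multiplied, and the first element is that of `P₁`. -/
def ΔleftWord : List NCP → HGap K ⊗[K] HGap K
  | [] => 0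
  | P :: w =>
    (∑ U ∈ Finset.univ.filter (fun U => P.part.IsUpperset U ∧ P.first ∉ U), cutTerm K P U) *
      (w.map fun Q => Δ K (FreeAlgebra.ι K Q)).prod

/-- As `ΔleftWord`, for the cuts `(L, U)` whose upperset `U` contains the first element. -/
def ΔrightWord : List NCP → HGap K ⊗[K] HGap K
  | [] => 0
  | P :: w =>
    (∑ U ∈ Finset.univ.filter (fun U => P.part.IsUpperset U ∧ P.first ∈ U), cutTerm K P U) *
      (w.map fun Q => Δ K (FreeAlgebra.ι K Q)).prod

/-- The left half-coproduct `Δ_≺`, extended from the augmentation ideal to `H` by `1 ↦ 0`. -/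
def Δleft : HGap K →ₗ[K] HGap K ⊗[K] HGap K :=
  (FreeAlgebra.basisFreeMonoid K NCP).constr K fun w => ΔleftWord K w.toList

/-- The right half-coproduct `Δ_≻`, extended from the augmentation ideal to `H` by `1 ↦ 0`. -/
def Δright : HGap K →ₗ[K] HGap K ⊗[K] HGap K :=
  (FreeAlgebra.basisFreeMonoid K NCP).constr K fun w => ΔrightWord K w.toList

variable {K}

/-- The left half-shuffle `f ≺ g` of linear forms, dual to `Δ_≺`. As `Δ_≺ x` contains the term
`x ⊗ 1`, and all left-hand factors are in the augmentation ideal, the conventions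
`f ≺ ε = f` and `ε ≺ f = 0`, for `f` with `f 1 = 0`, are included. -/
def leftShuffle (f g : Module.Dual K (HGap K)) : Module.Dual K (HGap K) :=
  LinearMap.mul' K K ∘ₗ TensorProduct.map f g ∘ₗ Δleft K

/-- The right half-shuffle `f ≻ g` of linear forms, dual to `Δ_≻`. As `Δ_≻ x` contains the term
`1 ⊗ x`, and all right-hand factors are in the augmentation ideal, the conventions
`ε ≻ f = f` and `f ≻ ε = 0`, for `f` with `f 1 = 0`, are included. -/
def rightShuffle (f g : Module.Dual K (HGap K)) : Module.Dual K (HGap K) :=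
  LinearMap.mul' K K ∘ₗ TensorProduct.map f g ∘ₗ Δright K

/-- `φ` solves `φ = ε + κ ≺ φ`, the equation that defines the left half-shuffle exponential
`φ` of `κ`. -/
def IsLeftExp (κ φ : Module.Dual K (HGap K)) : Prop :=
  φ = (ε K).toLinearMap + leftShuffle κ φ

/-- `φ` solves `φ = ε + φ ≻ κ`, the equation that defines the right half-shuffle exponential
`φ` of `κ`. -/
def IsRightExp (κ φ : Module.Dual K (HGap K)) : Prop :=
  φ = (ε K).toLinearMap + rightShuffle φ κ

variable (K)

/-- The infinitesimal character `e` of `H`: it vanishes on the unit and on products of two or more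
partitions, and its value on a partition with `k` blocks is `1` if `k = 1` and `0` otherwise. -/
def e : Module.Dual K (HGap K) :=
  (FreeAlgebra.basisFreeMonoid K NCP).constr K fun w =>
    match w.toList with
    | [P] => if P.numBlocks = 1 then (1 : K) else 0
    | _ => 0

end HGap

/-! ## The block-substitution bialgebra and its monoid of characters -/

/-- The commutative algebra `B` freely generated by `NCP`. -/
abbrev BBlock : Type _ := MvPolynomial NCP K

namespace BBlock

/-- The monomial `P / Q = ∏ P_{|τ}`, the product being over the blocks `τ` of `Q`. -/
def quot (P : NCP) (Q : NCPart P.deg) : BBlock K :=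
  ∏ τ : Q.Blocks, MvPolynomial.X (P.restrict (Q.block τ) (Q.block_nonempty τ))

/-- The coproduct of `B`: `δ P = ∑_{P ≤ Q} Q ⊗ P / Q`, over the noncrossing `Q ≥ P`. -/
def δ : BBlock K →ₐ[K] BBlock K ⊗[K] BBlock K :=
  MvPolynomial.aeval fun P : NCP =>
    ∑ Q ∈ Finset.univ.filter (fun Q : NCPart P.deg => P.part ≤ Q),
      MvPolynomial.X (⟨P.deg, P.pos, Q⟩ : NCP) ⊗ₜ[K] quot K P Q

/-- The counit of `B`, neutral for the convolution of characters. -/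
def ε : BBlock K →ₐ[K] K :=
  MvPolynomial.aeval fun P : NCP => if P.numBlocks = 1 then (1 : K) else 0

variable {K}

/-- The convolution product `φ * ψ` of characters of `B`. -/
def conv (φ ψ : BBlock K →ₐ[K] K) : BBlock K →ₐ[K] K :=
  (Algebra.TensorProduct.lift φ ψ fun _ _ => Commute.all _ _).comp (δ K)

/-- `φ` and `ψ` are inverse to each other in the monoid of characters of `B`. -/
def IsConvInverse (φ ψ : BBlock K →ₐ[K] K) : Prop :=
  conv φ ψ = ε K ∧ conv ψ φ = ε K

/-- The character of `B` (the abelianization of `H`) that corresponds to a character of `H`: the one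
with the same values on `NCP`. -/
def ofHGap (ψ : HGap K →ₐ[K] K) : BBlock K →ₐ[K] K :=
  MvPolynomial.aeval fun P : NCP => ψ (FreeAlgebra.ι K P)

end BBlock

end

/-! Both half-shuffle equations turn into recursions on monomials. In `e ≺ φ` the form `e` forces
the lowerset to be the single block of the first element, so the value at `P₁ ⋯ P_r` equals the
value after replacing `P₁` by its gaps around that block; hence `ψ_≺` is `1` on every partition. In
`φ ≻ e` the gap monomial of the upperset has to be a single one-block partition, so the first block
must be an initial interval, which is then removed; hence `ψ_≻` is the indicator `b` of boolean
partitions. Both recursions lower the number of elements, which gives uniqueness.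

The rest takes place in the monoid of functions on `NCP` under the convolution `cv`, with unit
`cvOne`. Let `i` be the indicator of irreducible partitions and `s` the multiplication by
`(-1)^(k+1)`. Since block numbers add up over the blocks of a coarsening, `s` is an involutive
automorphism of this monoid (`signed_cv`). Three identities carry the proof: `b * i = 1` (unique
decomposition into irreducibles), `s b * b = cvOne` and `1 * s i = b`, where `1` is the constant
function. They give `b⁻¹ = s b`, then `b⁻¹ * 1 = i`, then `i * s i = b⁻¹ * (1 * s i) = b⁻¹ * b =
cvOne`, and finally `1⁻¹ * b = i⁻¹ * b⁻¹ * b = s i`.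

The last two of the three identities are alternating sums over coarsenings of `P`. The coarsenings
that contribute are encoded by the sets of blocks of `P` on which their blocks start. These are the
families whose attached convex sets (rays, resp. convex hulls of blocks) cover everything, and
toggling a block whose set lies inside another one cancels the sum. -/

noncomputable section

/-! ## Noncrossing partitions of arbitrary finite linear orders -/

/-- A noncrossing partition of a linear order. -/
@[ext]
structure NCRel (α : Type*) [LinearOrder α] where
  rel : Setoid α
  nc : Noncrossing rel

namespace NCRel

variable {α β : Type*} [LinearOrder α] [LinearOrder β]

instance : PartialOrder (NCRel α) :=
  PartialOrder.lift NCRel.rel fun _ _ h => NCRel.ext h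

theorem le_iff {p q : NCRel α} : p ≤ q ↔ ∀ a b, p.rel a b → q.rel a b :=
  ⟨fun h _ _ hab => h hab, fun h a b hab => h a b hab⟩

instance [Finite α] : Finite (NCRel α) :=
  Finite.of_injective (fun P : NCRel α => fun a b : α => P.rel a b) (by
    intro P Q h
    ext a b
    exact iff_of_eq (congrFun (congrFun h a) b))

instance [Finite α] : Fintype (NCRel α) := Fintype.ofFinite _

/-- The pull-back of a noncrossing partition along an order embedding. -/
def comap (p : NCRel β) (f : α ↪o β) : NCRel α where
  rel := p.rel.comap f
  nc := fun _ _ _ _ hac hcb hbd hab hcd =>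
    p.nc _ _ _ _ (f.strictMono hac) (f.strictMono hcb) (f.strictMono hbd) hab hcd

@[simp]
theorem comap_rel (p : NCRel β) (f : α ↪o β) (a b : α) :
    (p.comap f).rel a b ↔ p.rel (f a) (f b) := Iff.rfl

/-- The restriction of a noncrossing partition to a subset. -/
def res (p : NCRel α) (s : α → Prop) : NCRel {x // s x} := p.comap (OrderEmbedding.subtype s)

/-- The noncrossing partition underlying an element of `NCPart n`. -/
def ofPart {n : ℕ} (P : NCPart n) : NCRel (Fin n) := ⟨P.rel, P.nc⟩

/-- The element of `NCPart n` given by a noncrossing partition of `Fin n`. -/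
def toPart {n : ℕ} (p : NCRel (Fin n)) : NCPart n := ⟨p.rel, p.nc⟩

/-- The standardization of a noncrossing partition. -/
def std [Fintype α] [Nonempty α] (p : NCRel α) : NCP :=
  ⟨Fintype.card α, Fintype.card_pos,
    (p.comap (Fintype.orderIsoFinOfCardEq α rfl).toOrderEmbedding).toPart⟩

end NCRel

/-- A finite chain has no order automorphism but the identity. Partitions can therefore live on
arbitrary finite chains, and subsets need no explicit renumbering. -/
theorem NCP.eq_of_orderIso (P Q : NCP) (e : Fin P.deg ≃o Fin Q.deg)
    (h : ∀ a b, P.part.rel a b ↔ Q.part.rel (e a) (e b)) : P = Q := by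
  obtain ⟨m, hm, P⟩ := P
  obtain ⟨n, hn, Q⟩ := Q
  obtain rfl : m = n := by simpa using Fintype.card_congr e.toEquiv
  obtain rfl : e = OrderIso.refl _ := Subsingleton.elim _ _
  congr
  ext a b
  exact h a b

namespace NCRel

variable {α β : Type*} [LinearOrder α] [LinearOrder β]
variable [Fintype α] [Nonempty α] [Fintype β] [Nonempty β]

/-- The unique monotone bijection from a standardization. -/
def stdIso (p : NCRel α) : Fin p.std.deg ≃o α := Fintype.orderIsoFinOfCardEq α rfl

theorem std_rel (p : NCRel α) (a b : Fin p.std.deg) :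
    p.std.part.rel a b ↔ p.rel (p.stdIso a) (p.stdIso b) := Iff.rfl

theorem eq_std (P : NCP) (p : NCRel α) (e : Fin P.deg ≃o α)
    (h : ∀ a b, P.part.rel a b ↔ p.rel (e a) (e b)) : P = p.std :=
  NCP.eq_of_orderIso _ _ (e.trans p.stdIso.symm) fun a b => by
    rw [std_rel]; simpa using h a b

theorem std_eq_std {p : NCRel α} {q : NCRel β} (e : α ≃o β)
    (h : ∀ a b, p.rel a b ↔ q.rel (e a) (e b)) : p.std = q.std :=
  eq_std _ _ (p.stdIso.trans e) fun a b => by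
    rw [std_rel]; simpa using h _ _

instance (P : NCP) : Nonempty (Fin P.deg) := ⟨P.first⟩

theorem std_ofPart (P : NCP) : (ofPart P.part).std = P :=
  (eq_std P _ (OrderIso.refl _) fun _ _ => Iff.rfl).symm

theorem restrict_eq_std (P : NCP) (X : Finset (Fin P.deg)) (hX : X.Nonempty)
    (e : {x // x ∈ X} ≃o α) (p : NCRel α)
    (h : ∀ a b : {x // x ∈ X}, P.part.rel a b ↔ p.rel (e a) (e b)) : P.restrict X hX = p.std :=
  eq_std _ _ ((X.orderIsoOfFin rfl).trans e) fun a b => by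
    refine Iff.trans ?_ (h _ _)
    rfl

instance fiber_nonempty (q : Setoid α) (τ : Quotient q) :
    Nonempty {x // Quotient.mk q x = τ} := by
  induction τ using Quotient.inductionOn with
  | h i => exact ⟨i, rfl⟩

/-- The standardized restriction of `p` to a block of `q`. -/
def atBlock (p : NCRel α) (q : Setoid α) (τ : Quotient q) : NCP :=
  (p.res fun x => Quotient.mk q x = τ).std

end NCRel

/-! ## Convolution of functions on noncrossing partitions -/

variable {K : Type*} [Field K]

/-- The convolution of the characters of `B`, on functions on `NCP`. -/
def cv (f g : NCP → K) (P : NCP) : K :=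
  ∑ Q ∈ Finset.univ.filter (fun Q : NCPart P.deg => P.part ≤ Q),
    f ⟨P.deg, P.pos, Q⟩ * ∏ τ : Q.Blocks, g (P.restrict (Q.block τ) (Q.block_nonempty τ))

theorem BBlock.conv_X (φ ψ : BBlock K →ₐ[K] K) (P : NCP) :
    BBlock.conv φ ψ (MvPolynomial.X P) =
      cv (fun P => φ (MvPolynomial.X P)) (fun P => ψ (MvPolynomial.X P)) P := by
  simp [BBlock.conv, BBlock.δ, cv, BBlock.quot, map_sum, map_prod]

namespace NCRel

variable {α β : Type*} [LinearOrder α] [LinearOrder β]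
variable [Fintype α] [Nonempty α] [Fintype β] [Nonempty β]

/-- Transport of noncrossing partitions along a monotone bijection. -/
def congr (e : α ≃o β) : NCRel β ≃ NCRel α where
  toFun p := p.comap e.toOrderEmbedding
  invFun p := p.comap e.symm.toOrderEmbedding
  left_inv p := by ext a b; simp
  right_inv p := by ext a b; simp

/-- `NCPart n` is the type of noncrossing partitions of `Fin n`. -/
def partEquiv (n : ℕ) : NCRel (Fin n) ≃ NCPart n where
  toFun := toPart
  invFun := ofPart
  left_inv _ := rfl
  right_inv _ := rfl

/-- Computes the convolution on any finite chain. Restrictions to blocks become subtypes, which can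
be iterated and glued. -/
theorem cv_std (f g : NCP → K) (p : NCRel α) :
    cv f g p.std = ∑ q ∈ Finset.univ.filter (fun q => p ≤ q),
      f q.std * ∏ τ : Quotient q.rel, g (p.atBlock q.rel τ) := by
  symm
  refine Finset.sum_equiv ((congr p.stdIso).trans (partEquiv _)) ?_ ?_
  · intro q
    simp only [Finset.mem_filter, Finset.mem_univ, true_and]
    constructor
    · intro h a b hab
      exact h hab
    · intro h a b hab
      have : q.rel (p.stdIso (p.stdIso.symm a)) (p.stdIso (p.stdIso.symm b)) :=
        @h (p.stdIso.symm a) (p.stdIso.symm b) (by rw [std_rel]; simpa using hab)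
      simpa only [OrderIso.apply_symm_apply] using this
  · intro q _
    congr 1
    symm
    refine Fintype.prod_equiv (Quotient.congr p.stdIso.toEquiv fun a b => Iff.rfl) _ _ ?_
    intro τ
    congr 1
    refine restrict_eq_std _ _ _
      ⟨Equiv.subtypeEquiv p.stdIso.toEquiv ?_, ?_⟩ _ ?_
    · intro a
      simp only [NCPart.block, Finset.mem_filter, Finset.mem_univ, true_and]
      induction τ using Quotient.inductionOn with
      | h i =>
        rw [Quotient.eq]
        exact (Quotient.eq (r := q.rel) (x := p.stdIso a) (y := p.stdIso i)).symm
    · intro a b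
      exact p.stdIso.le_iff_le
    · intro a b
      rfl

end NCRel

/-! ### Associativity of the convolution -/

namespace NCRel

variable {α β : Type*} [LinearOrder α] [LinearOrder β]

/-- The blocks of `r ≤ q` are the blocks of its restrictions to the blocks of `q`. -/
def sigmaBlocks {r q : NCRel α} (hrq : r ≤ q) :
    (Σ σ : Quotient q.rel, Quotient (r.res fun x => Quotient.mk q.rel x = σ).rel) ≃
      Quotient r.rel :=
  Equiv.ofBijective
    (fun x => Quotient.map' (s₂ := r.rel) Subtype.val (fun _ _ h => h) x.2) <| by
    constructor
    · rintro ⟨σ, τ⟩ ⟨σ', τ'⟩ h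
      induction τ using Quotient.inductionOn with | h i =>
      induction τ' using Quotient.inductionOn with | h j =>
      have hij : r.rel i.1 j.1 := Quotient.exact h
      obtain ⟨i, rfl⟩ := i
      obtain ⟨j, rfl⟩ := j
      have hq : Quotient.mk q.rel i = Quotient.mk q.rel j := Quotient.sound (hrq hij)
      -- The two blocks are first compared inside one common fibre; what remains is a change of
      -- fibre index, removed by generalizing it.
      have key : ∀ (σ' : Quotient q.rel) (hj : Quotient.mk q.rel j = σ')
          (hi : Quotient.mk q.rel i = σ'),
          (⟨σ', Quotient.mk _ ⟨i, hi⟩⟩ : Σ σ : Quotient q.rel,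
            Quotient (r.res fun x => Quotient.mk q.rel x = σ).rel) =
          ⟨σ', Quotient.mk _ ⟨j, hj⟩⟩ := by
        intro σ' hj hi
        congr 1
        exact Quotient.sound hij
      rw [← key _ rfl hq]
      clear hij h key
      generalize Quotient.mk q.rel j = s at hq
      subst hq
      rfl
    · intro τ
      induction τ using Quotient.inductionOn with | h i =>
      exact ⟨⟨Quotient.mk _ i, Quotient.mk _ ⟨i, rfl⟩⟩, rfl⟩

theorem atBlock_sigmaBlocks [Fintype α] (p : NCRel α) {r q : NCRel α} (hrq : r ≤ q)
    (σ : Quotient q.rel) (τ : Quotient (r.res fun x => Quotient.mk q.rel x = σ).rel) :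
    (p.res fun x => Quotient.mk q.rel x = σ).atBlock _ τ =
      p.atBlock r.rel (sigmaBlocks hrq ⟨σ, τ⟩) := by
  induction τ using Quotient.inductionOn with | h i =>
  refine std_eq_std ⟨⟨fun y => ⟨y.1.1, ?_⟩, fun x => ⟨⟨x.1, ?_⟩, ?_⟩, ?_, ?_⟩, ?_⟩ ?_
  · exact Quotient.sound (show r.rel _ _ from
      (Quotient.exact y.2 : (r.res fun x => Quotient.mk q.rel x = σ).rel y.1 i))
  · refine Eq.trans (Quotient.sound (hrq ?_)) i.2
    exact Quotient.exact x.2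
  · exact Quotient.sound (show r.rel _ _ from Quotient.exact x.2)
  · intro y; rfl
  · intro y; rfl
  · intro x y; rfl
  · intro x y; rfl

/-- The partition that restricts to given noncrossing partitions of the blocks of `q`. -/
def glue (q : NCRel α)
    (R : ∀ σ : Quotient q.rel, NCRel {x // Quotient.mk q.rel x = σ}) : NCRel α where
  rel :=
    { r := fun x y => ∃ σ, ∃ (hx : Quotient.mk q.rel x = σ) (hy : Quotient.mk q.rel y = σ),
        (R σ).rel ⟨x, hx⟩ ⟨y, hy⟩
      iseqv :=
        { refl := fun x => ⟨_, rfl, rfl, (R _).rel.refl _⟩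
          symm := fun ⟨σ, hx, hy, h⟩ => ⟨σ, hy, hx, (R _).rel.symm h⟩
          trans := by
            rintro x y z ⟨σ, hx, hy, h⟩ ⟨σ', hx', hy', h'⟩
            obtain rfl := hy.symm.trans hx'
            exact ⟨σ, hx, hy', (R _).rel.trans h h'⟩ } }
  nc := by
    rintro a b c d hac hcb hbd ⟨σ, ha, hb, h⟩ ⟨σ', hc, hd, h'⟩
    -- Crossing pairs lie in one block of `q`, as `q` is noncrossing; there `R σ` decides.
    have : q.rel a c := q.nc a b c d hac hcb hbd (Quotient.exact (ha.trans hb.symm))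
      (Quotient.exact (hc.trans hd.symm))
    obtain rfl : σ = σ' := ha.symm.trans ((Quotient.sound this).trans hc)
    exact ⟨σ, ha, hc, (R σ).nc ⟨a, ha⟩ ⟨b, hb⟩ ⟨c, hc⟩ ⟨d, hd⟩ hac hcb hbd h h'⟩

theorem glue_rel (q : NCRel α)
    (R : ∀ σ : Quotient q.rel, NCRel {x // Quotient.mk q.rel x = σ}) (σ : Quotient q.rel)
    (x y : {x // Quotient.mk q.rel x = σ}) : (q.glue R).rel x y ↔ (R σ).rel x y := by
  constructor
  · rintro ⟨σ', hx, hy, h⟩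
    obtain rfl : σ' = σ := hx.symm.trans x.2
    exact h
  · intro h
    exact ⟨σ, x.2, y.2, h⟩

theorem glue_le (q : NCRel α)
    (R : ∀ σ : Quotient q.rel, NCRel {x // Quotient.mk q.rel x = σ}) : q.glue R ≤ q := by
  rw [le_iff]
  rintro a b ⟨σ, ha, hb, -⟩
  exact Quotient.exact (ha.trans hb.symm)

theorem le_glue_iff {p q : NCRel α} (hpq : p ≤ q)
    (R : ∀ σ : Quotient q.rel, NCRel {x // Quotient.mk q.rel x = σ}) :
    p ≤ q.glue R ↔ ∀ σ, p.res _ ≤ R σ := by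
  constructor
  · intro h σ
    rw [le_iff] at h ⊢
    intro a b hab
    exact (glue_rel q R σ a b).1 (h _ _ hab)
  · intro h
    rw [le_iff]
    intro a b hab
    exact ⟨_, Quotient.sound (hpq hab), rfl, le_iff.1 (h _) ⟨a, _⟩ ⟨b, _⟩ hab⟩

theorem glue_res {r q : NCRel α} (hrq : r ≤ q) : (q.glue fun _ => r.res _) = r := by
  refine le_antisymm ?_ ((le_glue_iff hrq _).2 fun σ => le_rfl)
  rw [le_iff]
  rintro a b ⟨σ, ha, hb, h⟩
  exact h

theorem res_glue (q : NCRel α)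
    (R : ∀ σ : Quotient q.rel, NCRel {x // Quotient.mk q.rel x = σ}) (σ : Quotient q.rel) :
    (q.glue R).res _ = R σ := by
  ext x y
  exact glue_rel q R σ x y

variable [Fintype α]

theorem prod_atBlock_of_le (h : NCP → K) (p : NCRel α) {r q : NCRel α} (hrq : r ≤ q) :
    ∏ σ : Quotient q.rel, ∏ τ : Quotient (r.res fun x => Quotient.mk q.rel x = σ).rel,
        h ((p.res fun x => Quotient.mk q.rel x = σ).atBlock _ τ) =
      ∏ τ : Quotient r.rel, h (p.atBlock r.rel τ) := by
  rw [← Fintype.prod_sigma']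
  exact Fintype.prod_equiv (sigmaBlocks hrq) _ _ fun x => by
    rw [atBlock_sigmaBlocks p hrq]

variable [Nonempty α]

/-- Both sides are sums over chains `p ≤ r ≤ q`. For fixed `q`, restriction and `glue` identify
these `r` with families of noncrossing coarsenings of the restrictions of `p` to the blocks of `q`;
expanding the product of sums over blocks gives exactly such families. -/
theorem cv_assoc_std (f g h : NCP → K) (p : NCRel α) :
    cv (cv f g) h p.std = cv f (cv g h) p.std := by
  rw [cv_std, cv_std]
  simp only [cv_std, Finset.sum_mul]
  rw [Finset.sum_comm' (t' := Finset.univ.filter fun q => p ≤ q)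
    (s' := fun q => Finset.univ.filter fun r => p ≤ r ∧ r ≤ q)]
  swap
  · intro r q
    simp only [Finset.mem_filter, Finset.mem_univ, true_and]
    exact ⟨fun h => ⟨⟨h.1, h.2⟩, h.1.trans h.2⟩, fun h => ⟨h.1.1, h.1.2⟩⟩
  refine Finset.sum_congr rfl fun q hq => ?_
  have hpq : p ≤ q := (Finset.mem_filter.1 hq).2
  simp only [atBlock, cv_std]
  rw [Finset.prod_univ_sum, Finset.mul_sum]
  refine Finset.sum_bij' (fun r _ σ => r.res _) (fun R _ => q.glue R) ?_ ?_ ?_ ?_ ?_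
  · intro r hr
    simp only [Finset.mem_filter, Finset.mem_univ, true_and, Fintype.mem_piFinset] at hr ⊢
    intro σ
    exact le_iff.2 fun a b h => hr.1 h
  · intro R hR
    simp only [Finset.mem_filter, Finset.mem_univ, true_and, Fintype.mem_piFinset] at hR ⊢
    exact ⟨(le_glue_iff hpq R).2 hR, glue_le q R⟩
  · intro r hr
    exact glue_res (Finset.mem_filter.1 hr).2.2
  · intro R hR
    funext σ
    exact res_glue q R σ
  · intro r hr
    have hrq := (Finset.mem_filter.1 hr).2.2
    have := prod_atBlock_of_le h p hrq
    simp only [atBlock] at this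
    rw [Finset.prod_mul_distrib, this, mul_assoc]

theorem numBlocks_std (p : NCRel α) : p.std.numBlocks = Fintype.card (Quotient p.rel) := by
  rw [← Nat.card_eq_fintype_card]
  exact Nat.card_congr (Quotient.congr p.stdIso.toEquiv fun a b => Iff.rfl)

omit [Nonempty α] in
theorem sum_numBlocks {p q : NCRel α} (hpq : p ≤ q) :
    ∑ σ : Quotient q.rel, (p.atBlock q.rel σ).numBlocks = Fintype.card (Quotient p.rel) := by
  simp only [atBlock, numBlocks_std]
  rw [← Fintype.card_sigma]
  exact Fintype.card_congr (sigmaBlocks hpq)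

end NCRel

open NCRel

theorem cv_assoc (f g h : NCP → K) : cv (cv f g) h = cv f (cv g h) := by
  funext P
  rw [← std_ofPart P]
  exact cv_assoc_std f g h _

/-! ### The unit and the sign automorphism -/

/-- The unit of the convolution. -/
def cvOne (P : NCP) : K := if P.numBlocks = 1 then 1 else 0

theorem NCRel.numBlocks_std_eq_one_iff {α : Type*} [LinearOrder α] [Fintype α] [Nonempty α]
    (p : NCRel α) : p.std.numBlocks = 1 ↔ ∀ a b, p.rel a b := by
  rw [numBlocks_std, Fintype.card_eq_one_iff_nonempty_unique]
  constructor
  · rintro ⟨h⟩ a b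
    exact Quotient.exact (Subsingleton.elim (Quotient.mk p.rel a) (Quotient.mk p.rel b))
  · intro h
    obtain ⟨x⟩ := ‹Nonempty α›
    refine ⟨⟨⟨Quotient.mk _ x⟩, fun τ => ?_⟩⟩
    induction τ using Quotient.inductionOn with | h i =>
    exact Quotient.sound (h _ _)

theorem cvOne_cv (f : NCP → K) : cv cvOne f = f := by
  funext P
  rw [← std_ofPart P]
  generalize ofPart P.part = p
  rw [cv_std]
  let t : NCRel (Fin P.deg) := ⟨⊤, fun _ _ _ _ _ _ _ _ _ => trivial⟩
  have ht : ∀ a b, t.rel a b := fun a b => trivial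
  rw [Finset.sum_eq_single t]
  · rw [cvOne, if_pos ((numBlocks_std_eq_one_iff t).2 ht), one_mul]
    have : Unique (Quotient t.rel) := ⟨⟨Quotient.mk _ P.first⟩, fun τ => by
      induction τ using Quotient.inductionOn with | h i =>
      exact Quotient.sound (ht _ _)⟩
    rw [Fintype.prod_unique]
    congr 1
    refine std_eq_std ⟨⟨fun x => x.1, fun x => ⟨x, Subsingleton.elim _ _⟩, ?_, ?_⟩, ?_⟩ ?_
    · intro x; rfl
    · intro x; rfl
    · intro x y; rfl
    · intro x y; rfl
  · intro q _ hq
    rw [cvOne, if_neg, zero_mul]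
    intro h
    apply hq
    rw [numBlocks_std_eq_one_iff] at h
    ext a b
    exact ⟨fun _ => ht a b, fun _ => h a b⟩
  · intro h
    exact absurd (Finset.mem_filter.2 ⟨Finset.mem_univ _, fun a b _ => ht a b⟩) h

theorem cv_cvOne (f : NCP → K) : cv f cvOne = f := by
  funext P
  rw [← std_ofPart P]
  generalize ofPart P.part = p
  rw [cv_std, Finset.sum_eq_single p]
  · rw [Finset.prod_eq_one, mul_one]
    intro τ _
    rw [cvOne, if_pos]
    rw [atBlock, numBlocks_std_eq_one_iff]
    intro a b
    exact (Quotient.exact (a.2.trans b.2.symm) : p.rel a.1 b.1)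
  · intro q hq hne
    have hpq : p ≤ q := (Finset.mem_filter.1 hq).2
    obtain ⟨a, b, hab, hn⟩ : ∃ a b, q.rel a b ∧ ¬ p.rel a b := by
      by_contra! hcon
      exact hne (le_antisymm (le_iff.2 hcon) hpq)
    -- The block of `q` around `b` also contains `a`, so `p` restricted to it has more than one
    -- block.
    rw [Finset.prod_eq_zero (Finset.mem_univ (Quotient.mk q.rel b)), mul_zero]
    rw [cvOne, if_neg]
    rw [atBlock, numBlocks_std_eq_one_iff]
    intro h
    exact hn (h ⟨a, Quotient.sound hab⟩ ⟨b, rfl⟩)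
  · intro h
    exact absurd (Finset.mem_filter.2 ⟨Finset.mem_univ _, le_rfl⟩) h

/-- The multiplication of a function on `NCP` by the sign `(-1) ^ (k + 1)`. -/
def signed (f : NCP → K) (P : NCP) : K := (-1) ^ (P.numBlocks + 1) * f P

theorem NCRel.prod_sign {α : Type*} [LinearOrder α] [Fintype α] [Nonempty α] {p q : NCRel α}
    (hpq : p ≤ q) :
    ∏ τ : Quotient q.rel, (-1 : K) ^ ((p.atBlock q.rel τ).numBlocks + 1) =
      (-1) ^ (Fintype.card (Quotient p.rel) + Fintype.card (Quotient q.rel)) := by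
  rw [Finset.prod_pow_eq_pow_sum, Finset.sum_add_distrib, sum_numBlocks hpq]
  simp

/-- The blocks of `p` are distributed among those of `q`, so the sum of `k(p_{|τ}) + 1` over the
blocks `τ` of `q` is `k(p) + k(q)`. Together with `k(q) + 1` this has the parity of `k(p) + 1`. -/
theorem signed_cv (f g : NCP → K) : signed (cv f g) = cv (signed f) (signed g) := by
  funext P
  rw [← std_ofPart P]
  generalize ofPart P.part = p
  rw [signed, cv_std, cv_std, Finset.mul_sum]
  refine Finset.sum_congr rfl fun q hq => ?_
  have hpq : p ≤ q := (Finset.mem_filter.1 hq).2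
  simp only [signed]
  rw [Finset.prod_mul_distrib, prod_sign hpq, numBlocks_std, numBlocks_std]
  have : (-1 : K) ^ (Fintype.card (Quotient p.rel) + 1) =
      (-1) ^ (Fintype.card (Quotient q.rel) + 1) *
      (-1) ^ (Fintype.card (Quotient p.rel) + Fintype.card (Quotient q.rel)) := by
    rw [← pow_add, show ∀ a b : ℕ, a + 1 + (b + a) = b + 1 + 2 * a by intros; ring,
      pow_add _ _ (2 * _), pow_mul]
    simp
  rw [this]
  ring

theorem signed_cvOne : signed (cvOne : NCP → K) = cvOne := by
  funext P
  simp only [signed, cvOne]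
  split_ifs with h <;> simp [h]

theorem signed_signed (f : NCP → K) : signed (signed f) = f := by
  funext P
  simp only [signed]
  rw [← mul_assoc, ← mul_pow]
  simp

/-! ## Irreducible and boolean partitions -/

namespace NCRel

variable {α β : Type*} [LinearOrder α] [LinearOrder β]

/-- No block has elements on both sides of the cut just before `c`. -/
def IsCut (p : NCRel α) (c : α) : Prop := ∀ a b, a < c → c ≤ b → ¬ p.rel a b

/-- The first and the last element are in the same block. -/
def IsEnclosed (p : NCRel α) : Prop := ∃ a b, p.rel a b ∧ ∀ x, a ≤ x ∧ x ≤ b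

/-- All blocks are order-convex. -/
def IsConvex (p : NCRel α) : Prop := ∀ a x b, a ≤ x → x ≤ b → p.rel a b → p.rel a x

/-- Let `b` be the last element of the block of the first element `a`. If `b` had a successor `c`,
then `c` would be a cut: a block with elements `u < c ≤ v` has `u ≤ b < v`, so by noncrossing it is
the block of `a`, against the choice of `b`. -/
theorem isEnclosed_of_forall_isCut [Finite α] [Nonempty α] {p : NCRel α}
    (h : ∀ c, p.IsCut c → ∀ x, c ≤ x) : p.IsEnclosed := by
  obtain ⟨a, ha⟩ := Finite.exists_min (id : α → α)
  obtain ⟨b, hab, hb⟩ := (Set.toFinite {x | p.rel a x}).exists_maximalFor id _ ⟨a, p.rel.refl a⟩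
  replace hb : ∀ x, p.rel a x → x ≤ b := fun x hx => (le_total b x).elim (fun h => hb hx h) id
  refine ⟨a, b, hab, fun x => ⟨ha x, ?_⟩⟩
  by_contra! hlt
  obtain ⟨c, hbc, hc⟩ := (Set.toFinite {x | b < x}).exists_minimalFor id _ ⟨x, hlt⟩
  replace hc : ∀ x, b < x → c ≤ x := fun x hx => (le_total x c).elim (fun h => hc hx h) id
  refine absurd (h c ?_ b) (not_le.2 hbc)
  intro u v huc hcv huv
  have hub : u ≤ b := not_lt.1 fun hbu => absurd (hc u hbu) (not_le.2 huc)
  have hbv : b < v := lt_of_lt_of_le hbc hcv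
  have hau : p.rel a u := by
    rcases (ha u).eq_or_lt with h | hau
    · rw [show u = a from h.symm]
    · rcases hub.eq_or_lt with rfl | hub
      · exact hab
      · exact p.nc a b u v hau hub hbv hab huv
  exact absurd (hb v (p.rel.trans hau huv)) (not_le.2 hbv)

theorem isEnclosed_congr {p : NCRel α} {q : NCRel β} (e : α ≃o β)
    (h : ∀ a b, p.rel a b ↔ q.rel (e a) (e b)) : p.IsEnclosed ↔ q.IsEnclosed := by
  constructor
  · rintro ⟨a, b, hab, hx⟩
    refine ⟨e a, e b, (h _ _).1 hab, fun x => ?_⟩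
    rw [← e.apply_symm_apply x, e.le_iff_le, e.le_iff_le]
    exact hx _
  · rintro ⟨a, b, hab, hx⟩
    refine ⟨e.symm a, e.symm b, (h _ _).2 (by simpa using hab), fun x => ?_⟩
    rw [e.symm_apply_le, e.le_symm_apply]
    exact hx _

theorem isConvex_congr {p : NCRel α} {q : NCRel β} (e : α ≃o β)
    (h : ∀ a b, p.rel a b ↔ q.rel (e a) (e b)) : p.IsConvex ↔ q.IsConvex := by
  constructor
  · intro hp a x b hax hxb hab
    have := hp (e.symm a) (e.symm x) (e.symm b) (by simpa) (by simpa) ((h _ _).2 (by simpa using hab))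
    simpa using (h _ _).1 this
  · intro hq a x b hax hxb hab
    exact (h _ _).2 (hq _ _ _ (by simpa) (by simpa) ((h _ _).1 hab))

end NCRel

open NCRel

theorem NCPart.ordSum_castAdd_natAdd {m n : ℕ} (A : NCPart m) (B : NCPart n) (i : Fin m)
    (j : Fin n) : ¬ (A.ordSum B).rel (Fin.castAdd n i) (Fin.natAdd m j) := by
  rintro (⟨a, b, -, -, h⟩ | ⟨a, b, -, h, -⟩)
  · have := congrArg Fin.val h
    simp at this
    omega
  · have := congrArg Fin.val h
    simp at this
    omega

theorem NCPart.ordSum_castAdd {m n : ℕ} (A : NCPart m) (B : NCPart n) (i j : Fin m) :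
    (A.ordSum B).rel (Fin.castAdd n i) (Fin.castAdd n j) ↔ A.rel i j := by
  constructor
  · rintro (⟨a, b, h, ha, hb⟩ | ⟨a, b, -, h, -⟩)
    · obtain rfl := Fin.castAdd_injective _ _ ha
      obtain rfl := Fin.castAdd_injective _ _ hb
      exact h
    · have := congrArg Fin.val h
      simp at this
      omega
  · intro h
    exact Or.inl ⟨i, j, h, rfl, rfl⟩

theorem NCPart.ordSum_natAdd {m n : ℕ} (A : NCPart m) (B : NCPart n) (i j : Fin n) :
    (A.ordSum B).rel (Fin.natAdd m i) (Fin.natAdd m j) ↔ B.rel i j := by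
  constructor
  · rintro (⟨a, b, -, h, -⟩ | ⟨a, b, h, ha, hb⟩)
    · have := congrArg Fin.val h
      simp at this
      omega
    · obtain rfl := Fin.natAdd_injective _ _ ha
      obtain rfl := Fin.natAdd_injective _ _ hb
      exact h
  · intro h
    exact Or.inr ⟨i, j, h, rfl, rfl⟩

theorem NCPart.eq_ordSum {m n : ℕ} (P : NCPart (m + n)) (A : NCPart m) (B : NCPart n)
    (hA : ∀ i j, A.rel i j ↔ P.rel (Fin.castAdd n i) (Fin.castAdd n j))
    (hB : ∀ i j, B.rel i j ↔ P.rel (Fin.natAdd m i) (Fin.natAdd m j))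
    (h : ∀ i j, ¬ P.rel (Fin.castAdd n i) (Fin.natAdd m j)) : P = A.ordSum B := by
  ext x y
  induction x using Fin.addCases with
  | left i =>
    induction y using Fin.addCases with
    | left j => rw [ordSum_castAdd, hA]
    | right j => exact iff_of_false (h i j) (ordSum_castAdd_natAdd A B i j)
  | right i =>
    induction y using Fin.addCases with
    | left j =>
      exact iff_of_false (fun h' => h j i (P.rel.symm h')) fun h' => ordSum_castAdd_natAdd A B j i ((A.ordSum B).rel.symm h')
    | right j => rw [ordSum_natAdd, hB]

/-- Splits just before `c`, which belongs to the right summand; `h0` makes the left one non-empty.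
The clause on convexity feeds the induction for boolean partitions. -/
theorem NCP.exists_eq_ordSum (P : NCP) (c : Fin P.deg) (hc : (ofPart P.part).IsCut c)
    (h0 : P.first < c) :
    ∃ A B : NCP, P = A.ordSum B ∧
      ((ofPart P.part).IsConvex → (ofPart A.part).IsConvex ∧ (ofPart B.part).IsConvex) := by
  obtain ⟨d, hd, P⟩ := P
  obtain ⟨c, hcd⟩ := c
  obtain ⟨n, hn⟩ : ∃ n, d = c + (n + 1) := Nat.exists_eq_add_of_lt hcd
  subst hn
  let f : Fin c ↪o Fin (c + (n + 1)) := Fin.castAddOrderEmb (n + 1)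
  let g : Fin (n + 1) ↪o Fin (c + (n + 1)) := Fin.natAddOrderEmb c
  refine ⟨⟨c, h0, ((ofPart P).comap f).toPart⟩,
    ⟨n + 1, n.succ_pos, ((ofPart P).comap g).toPart⟩, ?_, ?_⟩
  · refine congrArg (NCP.mk _ _) (NCPart.eq_ordSum P _ _ (fun i j => Iff.rfl) (fun i j => Iff.rfl) ?_)
    intro i j
    exact hc _ _ (by simp [Fin.lt_def]) (by simp [Fin.le_def])
  · intro h
    exact ⟨fun a x b hax hxb hab => h (f a) (f x) (f b) (f.monotone hax) (f.monotone hxb) hab,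
      fun a x b hax hxb hab => h (g a) (g x) (g b) (g.monotone hax) (g.monotone hxb) hab⟩

theorem NCP.isIrreducible_iff (P : NCP) : P.IsIrreducible ↔ (ofPart P.part).IsEnclosed := by
  constructor
  · intro h
    refine isEnclosed_of_forall_isCut fun c hc x => ?_
    by_contra! hx
    obtain ⟨A, B, hAB, -⟩ := P.exists_eq_ordSum c hc
      (lt_of_le_of_lt (Fin.mk_le_of_le_val (Nat.zero_le _)) hx)
    exact h ⟨A, B, hAB⟩
  · rintro ⟨a, b, hab, hx⟩ ⟨A, B, rfl⟩
    obtain ⟨m, hm, A⟩ := A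
    obtain ⟨n, hn, B⟩ := B
    change Fin (m + n) at a b
    induction a using Fin.addCases with
    | left i =>
      induction b using Fin.addCases with
      | left j =>
        have : (Fin.natAdd m ⟨0, hn⟩ : Fin (m + n)).val ≤ (Fin.castAdd n j).val := (hx _).2
        simp at this
        omega
      | right j => exact NCPart.ordSum_castAdd_natAdd A B i j hab
    | right i =>
      have : (Fin.natAdd m i).val ≤ (Fin.castAdd n ⟨0, hm⟩ : Fin (m + n)).val := (hx _).1
      simp at this
      omega

/-- Induction on the degree: split at a cut, if there is one. Otherwise one block contains both
ends, and by convexity it is everything. -/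
theorem NCP.isBoolean_of_isConvex (N : ℕ) : ∀ P : NCP, P.deg = N →
    (ofPart P.part).IsConvex → P.IsBoolean := by
  induction N using Nat.strong_induction_on with
  | h N ih =>
    intro P hN hP
    by_cases hcut : ∃ c x, (ofPart P.part).IsCut c ∧ x < c
    · obtain ⟨c, x, hc, hx⟩ := hcut
      obtain ⟨A, B, hAB, hconv⟩ := P.exists_eq_ordSum c hc
        (lt_of_le_of_lt (Fin.mk_le_of_le_val (Nat.zero_le _)) hx)
      obtain ⟨hA, hB⟩ := hconv hP
      have hdeg : P.deg = A.deg + B.deg := congrArg NCP.deg hAB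
      have := A.pos
      have := B.pos
      rw [hAB]
      exact .ordSum _ _ (ih A.deg (by omega) A rfl hA) (ih B.deg (by omega) B rfl hB)
    · push Not at hcut
      obtain ⟨a, b, hab, hx⟩ : (ofPart P.part).IsEnclosed :=
        isEnclosed_of_forall_isCut fun c hc x => hcut c x hc
      obtain ⟨d, hd, P⟩ := P
      have : P = NCPart.coarsest d := by
        ext x y
        exact iff_of_true (P.rel.trans (P.rel.symm (hP a x b (hx x).1 (hx x).2 hab))
          (hP a y b (hx y).1 (hx y).2 hab)) trivial
      rw [this]
      exact .coarsest d hd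

theorem NCP.IsBoolean.isConvex {P : NCP} (h : P.IsBoolean) : (ofPart P.part).IsConvex := by
  induction h with
  | coarsest n hn => exact fun _ _ _ _ _ _ => trivial
  | ordSum A B _ _ hA hB =>
    obtain ⟨m, hm, A⟩ := A
    obtain ⟨n, hn, B⟩ := B
    intro a x b hax hxb hab
    change Fin (m + n) at a x b
    change (A.ordSum B).rel a b at hab
    change (A.ordSum B).rel a x
    replace hax : a.val ≤ x.val := hax
    replace hxb : x.val ≤ b.val := hxb
    induction a using Fin.addCases with
    | left i =>
      induction b using Fin.addCases with
      | left j =>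
        induction x using Fin.addCases with
        | left k =>
          exact (NCPart.ordSum_castAdd A B i k).2
            (hA i k j hax hxb ((NCPart.ordSum_castAdd A B i j).1 hab))
        | right k =>
          simp at hxb
          omega
      | right j => exact absurd hab (NCPart.ordSum_castAdd_natAdd A B i j)
    | right i =>
      induction x using Fin.addCases with
      | left k =>
        simp at hax
        omega
      | right k =>
        induction b using Fin.addCases with
        | left j =>
          simp at hxb
          omega
        | right j =>
          exact (NCPart.ordSum_natAdd A B i k).2
            (hB i k j (show i.val ≤ k.val by simpa using hax) (show k.val ≤ j.val by simpa using hxb)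
              ((NCPart.ordSum_natAdd A B i j).1 hab))

theorem NCP.isBoolean_iff (P : NCP) : P.IsBoolean ↔ (ofPart P.part).IsConvex :=
  ⟨fun h => h.isConvex, P.isBoolean_of_isConvex _ rfl⟩

variable {α : Type*} [LinearOrder α]

theorem NCRel.isIrreducible_std [Fintype α] [Nonempty α] (p : NCRel α) : p.std.IsIrreducible ↔ p.IsEnclosed := by
  rw [NCP.isIrreducible_iff]
  exact isEnclosed_congr p.stdIso fun a b => Iff.rfl

theorem NCRel.isBoolean_std [Fintype α] [Nonempty α] (p : NCRel α) : p.std.IsBoolean ↔ p.IsConvex := by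
  rw [NCP.isBoolean_iff]
  exact isConvex_congr p.stdIso fun a b => Iff.rfl

/-! ### Decomposition into irreducible partitions -/

variable (K) in
/-- The indicator function of the boolean partitions. -/
def boolInd (P : NCP) : K := if P.IsBoolean then 1 else 0

variable (K) in
/-- The indicator function of the irreducible partitions. -/
def irrInd (P : NCP) : K := if P.IsIrreducible then 1 else 0

/-- The finest convex partition that is coarser than `p`: its blocks are separated by the cuts of
`p`. -/
def NCRel.convexHull (p : NCRel α) : NCRel α where
  rel := Setoid.ker fun x => {c | p.IsCut c ∧ c ≤ x}
  nc := by
    intro a b c d hac hcb hbd hab hcd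
    change {c | _} = {c | _} at hab
    change {c | _} = {c | _}
    apply Set.Subset.antisymm
    · rintro u ⟨hu, hua⟩
      exact ⟨hu, hua.trans hac.le⟩
    · rintro u ⟨hu, huc⟩
      rw [hab]
      exact ⟨hu, huc.trans hcb.le⟩

theorem NCRel.convexHull_rel (p : NCRel α) (x y : α) :
    p.convexHull.rel x y ↔ ∀ c, p.IsCut c → (c ≤ x ↔ c ≤ y) := by
  change {c | _} = {c | _} ↔ _
  rw [Set.ext_iff]
  exact forall_congr' fun c => by simp

theorem NCRel.convexHull_isConvex (p : NCRel α) : p.convexHull.IsConvex := by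
  intro a x b hax hxb hab
  rw [convexHull_rel] at hab ⊢
  exact fun c hc => ⟨fun h => h.trans hax, fun h => (hab c hc).2 (h.trans hxb)⟩

theorem NCRel.le_convexHull (p : NCRel α) : p ≤ p.convexHull := by
  rw [le_iff]
  intro a b hab
  rw [convexHull_rel]
  intro c hc
  constructor
  · intro h
    by_contra! h'
    exact hc b a h' h (p.rel.symm hab)
  · intro h
    by_contra! h'
    exact hc a b h' h hab

/-- Every partition is, in a unique way, an iterated ordinal sum of irreducible partitions. -/
theorem cv_boolInd_irrInd : cv (boolInd K) (irrInd K) = fun _ => 1 := by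
  funext P
  rw [← std_ofPart P]
  generalize ofPart P.part = p
  rw [cv_std, Finset.sum_eq_single p.convexHull]
  · rw [boolInd, if_pos ((isBoolean_std _).2 p.convexHull_isConvex), one_mul]
    refine Finset.prod_eq_one fun τ _ => ?_
    rw [irrInd, if_pos]
    rw [atBlock, isIrreducible_std]
    refine isEnclosed_of_forall_isCut fun c hc x => ?_
    have hcx : p.convexHull.rel c x := Quotient.exact (c.2.trans x.2.symm)
    -- A cut of the restriction to a hull block is a cut of `p`: a block of `p` across it would, by
    -- convexity, lie in the same hull block. Cuts of `p` do not separate elements of a hull block,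
    -- so `c` is its first element.
    refine ((p.convexHull_rel _ _).1 hcx c ?_).1 le_rfl
    intro u v huc hcv huv
    have h1 : p.convexHull.rel u v := le_iff.1 p.le_convexHull _ _ huv
    have h2 : p.convexHull.rel u c := p.convexHull_isConvex u c v huc.le hcv h1
    have hu : Quotient.mk p.convexHull.rel u = τ := (Quotient.sound h2).trans c.2
    have hv : Quotient.mk p.convexHull.rel v = τ := (Quotient.sound h1).symm.trans hu
    exact hc ⟨u, hu⟩ ⟨v, hv⟩ huc hcv huv
  · intro q hq hne
    have hpq : p ≤ q := (Finset.mem_filter.1 hq).2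
    by_contra hn
    have hb : q.IsConvex := by
      rw [← isBoolean_std]
      by_contra hb
      rw [boolInd, if_neg hb, zero_mul] at hn
      exact hn rfl
    have hi : ∀ τ : Quotient q.rel, (p.res fun x => Quotient.mk q.rel x = τ).IsEnclosed := by
      intro τ
      rw [← isIrreducible_std]
      by_contra hi
      rw [Finset.prod_eq_zero (Finset.mem_univ τ), mul_zero] at hn
      · exact hn rfl
      · rw [irrInd, atBlock, if_neg hi]
    apply hne
    refine le_antisymm (le_iff.2 fun x y hxy => ?_) (le_iff.2 fun x y hxy => ?_)
    · rw [convexHull_rel]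
      -- A cut of `p` cannot separate a block of `q`, because some block of `p` joins its two ends.
      have key : ∀ x y, q.rel x y → ∀ c, p.IsCut c → c ≤ x → c ≤ y := by
        intro x y hxy c hc hcx
        obtain ⟨a, b, hab, h⟩ := hi (Quotient.mk q.rel x)
        by_contra! hyc
        exact hc a b (lt_of_le_of_lt (h ⟨y, Quotient.sound (q.rel.symm hxy)⟩).1 hyc)
          (hcx.trans (h ⟨x, rfl⟩).2) hab
      exact fun c hc => ⟨key x y hxy c hc, key y x (q.rel.symm hxy) c hc⟩
    -- Conversely, the first element `c` of a block of the convex `q` is a cut of `p`, so elements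
    -- that no cut separates lie in one block of `q`.
    · have key : ∀ x y, x ≤ y → p.convexHull.rel x y → q.rel x y := by
        intro x y hle hxy
        obtain ⟨c, hyc, hc⟩ :=
          (Set.toFinite {x | q.rel y x}).exists_minimalFor id _ ⟨y, q.rel.refl y⟩
        replace hc : ∀ x, q.rel y x → c ≤ x :=
          fun x hx => (le_total x c).elim (fun h => hc hx h) id
        have hcut : p.IsCut c := by
          intro u v huc hcv huv
          have h1 : q.rel u c := hb u c v huc.le hcv (hpq huv)
          exact absurd (hc u (q.rel.trans hyc (q.rel.symm h1))) (not_le.2 huc)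
        have hcx : c ≤ x := ((p.convexHull_rel x y).1 hxy c hcut).2 (hc y (q.rel.refl y))
        exact q.rel.trans (q.rel.symm (hb c x y hcx hle (q.rel.symm hyc))) (q.rel.symm hyc)
      rcases le_total x y with h | h
      · exact key x y h hxy
      · exact q.rel.symm (key y x h (p.convexHull.rel.symm hxy))
  · intro h
    exact absurd (Finset.mem_filter.2 ⟨Finset.mem_univ _, p.le_convexHull⟩) h

/-! ## Coarsenings encoded by sets of blocks -/

namespace NCRel

variable {α : Type*} [LinearOrder α] [Fintype α]

theorem exists_lo (p : NCRel α) (q : Quotient p.rel) :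
    ∃ a, Quotient.mk p.rel a = q ∧ ∀ x, Quotient.mk p.rel x = q → a ≤ x := by
  obtain ⟨a, ha, h⟩ := (Set.toFinite {x | Quotient.mk p.rel x = q}).exists_minimalFor id _
    (Quotient.exists_rep q)
  exact ⟨a, ha, fun x hx => (le_total x a).elim (fun h' => h hx h') id⟩

theorem exists_hi (p : NCRel α) (q : Quotient p.rel) :
    ∃ a, Quotient.mk p.rel a = q ∧ ∀ x, Quotient.mk p.rel x = q → x ≤ a := by
  obtain ⟨a, ha, h⟩ := (Set.toFinite {x | Quotient.mk p.rel x = q}).exists_maximalFor id _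
    (Quotient.exists_rep q)
  exact ⟨a, ha, fun x hx => (le_total a x).elim (fun h' => h hx h') id⟩

/-- The smallest element of a block. -/
def lo (p : NCRel α) (q : Quotient p.rel) : α := (p.exists_lo q).choose

/-- The largest element of a block. -/
def hi (p : NCRel α) (q : Quotient p.rel) : α := (p.exists_hi q).choose

theorem mk_lo (p : NCRel α) (q : Quotient p.rel) : Quotient.mk p.rel (p.lo q) = q :=
  (p.exists_lo q).choose_spec.1

theorem lo_le (p : NCRel α) {q : Quotient p.rel} {x : α} (h : Quotient.mk p.rel x = q) :
    p.lo q ≤ x := (p.exists_lo q).choose_spec.2 x h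

theorem mk_hi (p : NCRel α) (q : Quotient p.rel) : Quotient.mk p.rel (p.hi q) = q :=
  (p.exists_hi q).choose_spec.1

theorem le_hi (p : NCRel α) {q : Quotient p.rel} {x : α} (h : Quotient.mk p.rel x = q) :
    x ≤ p.hi q := (p.exists_hi q).choose_spec.2 x h

theorem lo_injective (p : NCRel α) : Function.Injective p.lo := fun q q' h => by
  rw [← p.mk_lo q, h, p.mk_lo]

theorem lo_rel_hi (p : NCRel α) (q : Quotient p.rel) : p.rel (p.lo q) (p.hi q) :=
  Quotient.exact ((p.mk_lo q).trans (p.mk_hi q).symm)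

/-- The blocks of `p` that contain the smallest element of a block of `r`. -/
def bases (p r : NCRel α) : Finset (Quotient p.rel) :=
  Finset.univ.filter fun q => ∀ y, r.rel (p.lo q) y → p.lo q ≤ y

theorem mem_bases {p r : NCRel α} {q : Quotient p.rel} :
    q ∈ bases p r ↔ ∀ y, r.rel (p.lo q) y → p.lo q ≤ y := by simp [bases]

theorem exists_mem_bases {p r : NCRel α} (h : p ≤ r) (x : α) :
    ∃ q ∈ bases p r, r.rel (p.lo q) x := by
  -- The first element of a block of `r` is also the first element of its block in `p`.
  have h1 : p.lo (Quotient.mk _ (r.lo (Quotient.mk _ x))) = r.lo (Quotient.mk _ x) := by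
    refine le_antisymm (p.lo_le rfl) (r.lo_le ?_)
    rw [← r.mk_lo (Quotient.mk _ x)]
    refine Quotient.sound (h ?_)
    rw [r.mk_lo]
    exact Quotient.exact (p.mk_lo _)
  refine ⟨Quotient.mk _ (r.lo (Quotient.mk _ x)), mem_bases.2 fun y hy => ?_, ?_⟩
  · rw [h1] at hy ⊢
    exact r.lo_le ((Quotient.sound (r.rel.symm hy)).trans (r.mk_lo _))
  · rw [h1]
    exact Quotient.exact (r.mk_lo _)

theorem card_bases {p r : NCRel α} (h : p ≤ r) :
    (bases p r).card = Fintype.card (Quotient r.rel) := by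
  rw [← Finset.card_univ]
  refine Finset.card_bij (fun q _ => Quotient.mk r.rel (p.lo q)) (fun _ _ => Finset.mem_univ _) ?_ ?_
  · intro q hq q' hq' hqq
    have : r.rel (p.lo q) (p.lo q') := Quotient.exact hqq
    exact p.lo_injective
      (le_antisymm (mem_bases.1 hq _ this) (mem_bases.1 hq' _ (r.rel.symm this)))
  · intro τ _
    induction τ using Quotient.inductionOn with | h i =>
    obtain ⟨q, hq, hr⟩ := exists_mem_bases h i
    exact ⟨q, hq, Quotient.sound hr⟩

/-! ### Coarsenings and covering families of nested sets -/

/-- A nested family of convex sets, attached to the blocks of `p`. -/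
structure IsNesting (p : NCRel α) (C : Quotient p.rel → α → Prop) : Prop where
  lo_mem : ∀ q, C q (p.lo q)
  lo_le : ∀ q x, C q x → p.lo q ≤ x
  ordConnected : ∀ q x y z, C q x → C q z → x ≤ y → y ≤ z → C q y
  rel : ∀ q x y, p.rel x y → C q x → C q y
  nested : ∀ q q' x y, C q x → C q' x → p.lo q ≤ p.lo q' → C q' y → C q y

namespace IsNesting

variable {p : NCRel α} {C : Quotient p.rel → α → Prop} (hC : p.IsNesting C)

include hC

/-- The partition of the elements according to the sets `C q`, `q ∈ S`, that contain them. -/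
def ofBases (S : Finset (Quotient p.rel)) : NCRel α where
  rel := Setoid.ker fun x => {q | q ∈ S ∧ C q x}
  nc := by
    intro a b c d hac hcb hbd hab hcd
    change {q | _} = {q | _} at hab hcd
    change {q | _} = {q | _}
    apply Set.Subset.antisymm
    · rintro q ⟨hq, hqa⟩
      have hqb : q ∈ S ∧ C q b := (Set.ext_iff.1 hab q).1 ⟨hq, hqa⟩
      exact ⟨hq, hC.ordConnected q a c b hqa hqb.2 hac.le hcb.le⟩
    · rintro q ⟨hq, hqc⟩
      have hqd : q ∈ S ∧ C q d := (Set.ext_iff.1 hcd q).1 ⟨hq, hqc⟩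
      exact (Set.ext_iff.1 hab q).2 ⟨hq, hC.ordConnected q c b d hqc hqd.2 hcb.le hbd.le⟩

theorem ofBases_rel {S : Finset (Quotient p.rel)} {x y : α} :
    (hC.ofBases S).rel x y ↔ ∀ q ∈ S, C q x ↔ C q y := by
  change {q | _} = {q | _} ↔ _
  rw [Set.ext_iff]
  exact forall_congr' fun q => by simp

theorem le_ofBases (S : Finset (Quotient p.rel)) : p ≤ hC.ofBases S := by
  rw [le_iff]
  intro a b hab
  rw [ofBases_rel]
  exact fun q _ => ⟨hC.rel q a b hab, hC.rel q b a (p.rel.symm hab)⟩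

/-- Take the innermost set `C q`, `q ∈ S`, around `x`, that is, the one with the largest `lo`. By
nestedness every other set of the family contains both `lo q` and `x`, or neither. -/
theorem exists_base {S : Finset (Quotient p.rel)} {x : α} (hS : ∃ q ∈ S, C q x) :
    ∃ q ∈ S, C q x ∧ (hC.ofBases S).rel (p.lo q) x := by
  obtain ⟨q₀, hq₀, h₀⟩ := hS
  obtain ⟨q, hq, hmax⟩ := (S.filter fun q => C q x).exists_max_image p.lo
    ⟨q₀, Finset.mem_filter.2 ⟨hq₀, h₀⟩⟩
  rw [Finset.mem_filter] at hq
  refine ⟨q, hq.1, hq.2, hC.ofBases_rel.2 fun r hr => ⟨fun h => ?_, fun h => ?_⟩⟩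
  · exact hC.nested r q _ x h (hC.lo_mem q) (hC.lo_le _ _ h) hq.2
  · exact hC.nested r q x _ h hq.2 (hmax r (Finset.mem_filter.2 ⟨hr, h⟩)) (hC.lo_mem q)

theorem bases_ofBases {S : Finset (Quotient p.rel)} (hS : ∀ x, ∃ q ∈ S, C q x) :
    bases p (hC.ofBases S) = S := by
  ext q
  rw [mem_bases]
  constructor
  · intro h
    obtain ⟨r, hr, hrx, hrel⟩ := hC.exists_base (hS (p.lo q))
    have h1 := h _ ((hC.ofBases S).rel.symm hrel)
    rwa [p.lo_injective (le_antisymm h1 (hC.lo_le _ _ hrx))]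
  · intro hq y hy
    exact hC.lo_le _ _ ((hC.ofBases_rel.1 hy q hq).1 (hC.lo_mem q))

/-- `r` can be recovered from its bases. -/
def Encodes (r : NCRel α) : Prop :=
  (∀ x, ∃ q ∈ bases p r, C q x) ∧ hC.ofBases (bases p r) = r

theorem sum_sign_eq_sum_bases :
    ∑ r ∈ Finset.univ.filter (fun r => p ≤ r ∧ hC.Encodes r), (-1 : K) ^ Fintype.card (Quotient r.rel) =
      ∑ S ∈ Finset.univ.filter (fun S : Finset (Quotient p.rel) => ∀ x, ∃ q ∈ S, C q x),
        (-1 : K) ^ S.card := by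
  refine Finset.sum_bij' (fun r _ => bases p r) (fun S _ => hC.ofBases S) ?_ ?_ ?_ ?_ ?_
  · intro r hr
    simp only [Finset.mem_filter, Finset.mem_univ, true_and] at hr ⊢
    exact hr.2.1
  · intro S hS
    simp only [Finset.mem_filter, Finset.mem_univ, true_and] at hS ⊢
    refine ⟨hC.le_ofBases S, ?_⟩
    rw [Encodes, hC.bases_ofBases hS]
    exact ⟨hS, rfl⟩
  · intro r hr
    simp only [Finset.mem_filter, Finset.mem_univ, true_and] at hr
    exact hr.2.2
  · intro S hS
    simp only [Finset.mem_filter, Finset.mem_univ, true_and] at hS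
    exact hC.bases_ofBases hS
  · intro r hr
    simp only [Finset.mem_filter, Finset.mem_univ, true_and] at hr
    rw [card_bases hr.1]

/-- Toggling `q₀` is a sign-reversing involution. It preserves covering: whichever `r ∈ S` covers
`lo q₁` starts before `q₀`, so `r ≠ q₀`, and by nestedness `C r` contains `C q₀`. -/
theorem sum_bases_eq_zero {q₀ q₁ : Quotient p.rel} (hne : q₀ ≠ q₁) (h : C q₁ (p.lo q₀)) :
    ∑ S ∈ Finset.univ.filter (fun S : Finset (Quotient p.rel) => ∀ x, ∃ q ∈ S, C q x),
        (-1 : K) ^ S.card = 0 := by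
  have hlt : p.lo q₁ < p.lo q₀ :=
    lt_of_le_of_ne (hC.lo_le _ _ h) fun h' => hne (p.lo_injective h').symm
  refine Finset.sum_involution (fun S _ => if q₀ ∈ S then S.erase q₀ else insert q₀ S) ?_ ?_ ?_ ?_
  · intro S _
    split_ifs with hq
    · rw [← Finset.card_erase_add_one hq, pow_succ]
      ring
    · rw [Finset.card_insert_of_notMem hq, pow_succ]
      ring
  · intro S _ _ hS
    split_ifs at hS with hq
    · rw [← hS] at hq
      simp at hq
    · exact hq (by rw [← hS]; simp)
  · intro S hS
    simp only [Finset.mem_filter, Finset.mem_univ, true_and] at hS ⊢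
    intro x
    split_ifs with hq
    · obtain ⟨q, hqS, hqx⟩ := hS x
      by_cases hqq : q = q₀
      · subst hqq
        obtain ⟨r, hrS, hr⟩ := hS (p.lo q₁)
        have hle : p.lo r ≤ p.lo q₁ := hC.lo_le _ _ hr
        refine ⟨r, Finset.mem_erase.2 ⟨?_, hrS⟩, ?_⟩
        · rintro rfl
          exact absurd hle (not_le.2 hlt)
        · have h1 : C r (p.lo q) := hC.nested r q₁ _ _ hr (hC.lo_mem q₁) hle h
          exact hC.nested r q _ x h1 (hC.lo_mem q) (hle.trans hlt.le) hqx
      · exact ⟨q, Finset.mem_erase.2 ⟨hqq, hqS⟩, hqx⟩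
    · obtain ⟨q, hqS, hqx⟩ := hS x
      exact ⟨q, Finset.mem_insert_of_mem hqS, hqx⟩
  · intro S _
    by_cases hq : q₀ ∈ S <;> simp [hq]

/-- Here `lo q` is covered by `C q` alone, so the full set is the only covering family. -/
theorem sum_bases_eq_one (h : ∀ q₀ q₁ : Quotient p.rel, C q₁ (p.lo q₀) → q₀ = q₁) :
    ∑ S ∈ Finset.univ.filter (fun S : Finset (Quotient p.rel) => ∀ x, ∃ q ∈ S, C q x),
        (-1 : K) ^ S.card = (-1) ^ Fintype.card (Quotient p.rel) := by
  have : (Finset.univ.filter fun S : Finset (Quotient p.rel) => ∀ x, ∃ q ∈ S, C q x) =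
      {Finset.univ} := by
    ext S
    simp only [Finset.mem_filter, Finset.mem_univ, true_and, Finset.mem_singleton]
    constructor
    · intro hS
      refine Finset.eq_univ_of_forall fun q => ?_
      obtain ⟨r, hr, hrq⟩ := hS (p.lo q)
      rwa [h q r hrq]
    · rintro rfl x
      exact ⟨Quotient.mk _ x, Finset.mem_univ _, hC.rel _ (p.lo _) _
        (Quotient.exact (p.mk_lo _)) (hC.lo_mem _)⟩
  rw [this, Finset.sum_singleton, Finset.card_univ]

end IsNesting

/-- The convex hulls of the blocks of a noncrossing partition are nested. -/
theorem isNesting_hull (p : NCRel α) : p.IsNesting fun q x => p.lo q ≤ x ∧ x ≤ p.hi q where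
  lo_mem q := ⟨le_rfl, p.lo_le (p.mk_hi q)⟩
  lo_le q x h := h.1
  ordConnected q x y z hx hz hxy hyz := ⟨hx.1.trans hxy, hyz.trans hz.2⟩
  rel q x y hxy := by
    rintro ⟨h1, h2⟩
    by_cases hq : Quotient.mk p.rel x = q
    · have : Quotient.mk p.rel y = q := (Quotient.sound (p.rel.symm hxy)).trans hq
      exact ⟨p.lo_le this, p.le_hi this⟩
    have h1 : p.lo q < x := lt_of_le_of_ne h1 fun h => hq (by rw [← h, p.mk_lo])
    have h2 : x < p.hi q := lt_of_le_of_ne h2 fun h => hq (by rw [h, p.mk_hi])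
    -- A block that enters the hull of another block and leaves it would cross that block.
    by_contra hcon
    rw [not_and_or, not_le, not_le] at hcon
    apply hq
    rcases hcon with h | h
    · have := p.nc y x (p.lo q) (p.hi q) h h1 h2 (p.rel.symm hxy) (p.lo_rel_hi q)
      rw [← p.mk_lo q]
      exact Quotient.sound (p.rel.trans hxy this)
    · have := p.nc (p.lo q) (p.hi q) x y h1 h2 h (p.lo_rel_hi q) hxy
      rw [← p.mk_lo q]
      exact Quotient.sound (p.rel.symm this)
  nested q q' x y := by
    rintro ⟨h1, h2⟩ ⟨h3, h4⟩ hlo ⟨h5, h6⟩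
    refine ⟨hlo.trans h5, h6.trans ?_⟩
    by_contra! hlt
    have hne : q ≠ q' := by
      rintro rfl
      exact lt_irrefl _ hlt
    have hlo : p.lo q < p.lo q' := lt_of_le_of_ne hlo fun h => hne (p.lo_injective h)
    have hmid : p.lo q' < p.hi q :=
      lt_of_le_of_ne (h3.trans h2) fun h => hne (by rw [← p.mk_hi q, ← h, p.mk_lo])
    have := p.nc _ _ _ _ hlo hmid hlt (p.lo_rel_hi q) (p.lo_rel_hi q')
    apply hne
    rw [← p.mk_lo q, ← p.mk_lo q']
    exact Quotient.sound this

/-- The rays that start at the blocks of a convex partition are nested. -/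
theorem IsConvex.isNesting {p : NCRel α} (hp : p.IsConvex) : p.IsNesting fun q x => p.lo q ≤ x where
  lo_mem q := le_rfl
  lo_le q x h := h
  ordConnected q x y z hx _ hxy _ := hx.trans hxy
  rel q x y hxy h := by
    by_contra! hlt
    have := hp y (p.lo q) x hlt.le h (p.rel.symm hxy)
    exact absurd (p.lo_le ((Quotient.sound this).trans (p.mk_lo q))) (not_le.2 hlt)
  nested q q' x y _ _ h h' := h.trans h'

/-- A partition into intervals is determined by the first elements of its blocks, and classes cut
out by rays are intervals. -/
theorem IsConvex.encodes_iff {p : NCRel α} (hp : p.IsConvex) {r : NCRel α} (hpr : p ≤ r) :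
    hp.isNesting.Encodes r ↔ r.IsConvex := by
  constructor
  · rintro ⟨-, h⟩
    rw [← h]
    intro a x b hax hxb hab
    rw [IsNesting.ofBases_rel] at hab ⊢
    exact fun q hq => ⟨fun h => h.trans hax, fun h => (hab q hq).2 (h.trans hxb)⟩
  · intro hr
    refine ⟨fun x => ?_, le_antisymm (le_iff.2 fun x y hxy => ?_) (le_iff.2 fun x y hxy => ?_)⟩
    · obtain ⟨q, hq, hqx⟩ := exists_mem_bases hpr x
      exact ⟨q, hq, mem_bases.1 hq x hqx⟩
    · rw [IsNesting.ofBases_rel] at hxy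
      have key : ∀ x y, x ≤ y → (∀ q ∈ bases p r, p.lo q ≤ x ↔ p.lo q ≤ y) → r.rel x y := by
        intro x y hle h
        obtain ⟨q, hq, hqy⟩ := exists_mem_bases hpr y
        have hqx := (h q hq).2 (mem_bases.1 hq y hqy)
        exact r.rel.trans (r.rel.symm (hr _ _ _ hqx hle hqy)) hqy
      rcases le_total x y with h | h
      · exact key x y h hxy
      · exact r.rel.symm (key y x h fun q hq => (hxy q hq).symm)
    · rw [IsNesting.ofBases_rel]
      have key : ∀ x y, r.rel x y → ∀ q ∈ bases p r, p.lo q ≤ x → p.lo q ≤ y := by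
        intro x y hxy q hq h
        by_contra! hlt
        have := hr y (p.lo q) x hlt.le h (r.rel.symm hxy)
        exact absurd (mem_bases.1 hq y (r.rel.symm this)) (not_le.2 hlt)
      exact fun q hq => ⟨key x y hxy q hq, key y x (r.rel.symm hxy) q hq⟩

/-- If `p` is enclosed on each block of `r`, the base of that block is the block of `p` joining its
two ends. The hull of the base is then the hull of the whole block, and `r`, being noncrossing, is
determined by these hulls. -/
theorem encodes_iff_isEnclosed {p r : NCRel α} (hpr : p ≤ r) :
    p.isNesting_hull.Encodes r ↔
    ∀ τ : Quotient r.rel, (p.res fun x => Quotient.mk r.rel x = τ).IsEnclosed := by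
  constructor
  · rintro ⟨h1, h2⟩ τ
    induction τ using Quotient.inductionOn with | h x =>
    obtain ⟨q, hq, hqx, hrel⟩ := p.isNesting_hull.exists_base (h1 x)
    rw [h2] at hrel
    refine ⟨⟨p.lo q, Quotient.sound hrel⟩, ⟨p.hi q,
      Quotient.sound (r.rel.trans (r.rel.symm (hpr (p.lo_rel_hi q))) hrel)⟩, p.lo_rel_hi q, ?_⟩
    rintro ⟨y, hy⟩
    have hxy : r.rel x y := r.rel.symm (Quotient.exact hy)
    rw [← h2, IsNesting.ofBases_rel] at hxy
    exact (hxy q hq).1 hqx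
  · intro h
    have hull : ∀ x, ∃ q ∈ bases p r, r.rel (p.lo q) x ∧ p.lo q ≤ x ∧ x ≤ p.hi q := by
      intro x
      obtain ⟨q, hq, hqx⟩ := exists_mem_bases hpr x
      refine ⟨q, hq, hqx, mem_bases.1 hq x hqx, ?_⟩
      obtain ⟨a, b, hab, hx⟩ := h (Quotient.mk _ x)
      have ha : p.lo q = a.1 := le_antisymm
        (mem_bases.1 hq _ (r.rel.trans hqx (r.rel.symm (Quotient.exact a.2))))
        (hx ⟨p.lo q, Quotient.sound hqx⟩).1
      refine le_trans (hx ⟨x, rfl⟩).2 (p.le_hi ?_)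
      refine Eq.trans ?_ (p.mk_lo q)
      rw [ha]
      exact Quotient.sound (p.rel.symm hab)
    refine ⟨fun x => ?_, le_antisymm (le_iff.2 fun x y hxy => ?_) (le_iff.2 fun x y hxy => ?_)⟩
    · obtain ⟨q, hq, -, h⟩ := hull x
      exact ⟨q, hq, h⟩
    · rw [IsNesting.ofBases_rel] at hxy
      obtain ⟨q, hq, hqx, hqx'⟩ := hull x
      obtain ⟨q', hq', hqy, hqy'⟩ := hull y
      -- Suppose `x` and `y` lie in the hulls of both bases, and `q` starts first. Then `x` is
      -- between the ends of `q'`, so the pairs `lo q, x` and `lo q', hi q'` cross unless an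
      -- endpoint coincides.
      have key : ∀ q q' x y, r.rel (p.lo q) x → r.rel (p.lo q') y → q ∈ bases p r →
          p.lo q ≤ p.lo q' → (p.lo q ≤ y ∧ y ≤ p.hi q) →
          (p.lo q' ≤ x ∧ x ≤ p.hi q') → r.rel x y := by
        intro q q' x y hqx hqy hq hle hqy' hqx'
        have hhi : r.rel (p.lo q') (p.hi q') := hpr (p.lo_rel_hi q')
        rcases hle.eq_or_lt with heq | hlt
        · rw [heq] at hqx
          exact r.rel.trans (r.rel.symm hqx) hqy
        rcases hqx'.1.eq_or_lt with heq | hlt'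
        · rwa [← heq]
        rcases hqx'.2.eq_or_lt with heq | hlt''
        · rw [heq]
          exact r.rel.trans (r.rel.symm hhi) hqy
        · have := r.nc _ _ _ _ hlt hlt' hlt'' hqx hhi
          exact r.rel.trans (r.rel.symm hqx) (r.rel.trans this hqy)
      rcases le_total (p.lo q) (p.lo q') with hle | hle
      · exact key q q' x y hqx hqy hq hle ((hxy q hq).1 hqx') ((hxy q' hq').2 hqy')
      · exact r.rel.symm
          (key q' q y x hqy hqx hq' hle ((hxy q' hq').2 hqy') ((hxy q hq).1 hqx'))
    · rw [IsNesting.ofBases_rel]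
      -- The block of `r` based at `q` stays below `hi q` by enclosure; any other block inside the
      -- hull of `q` stays there by noncrossing.
      have key : ∀ x y, r.rel x y → ∀ q ∈ bases p r, (p.lo q ≤ x ∧ x ≤ p.hi q) →
          (p.lo q ≤ y ∧ y ≤ p.hi q) := by
        intro x y hxy q hq hqx
        have hhi : r.rel (p.lo q) (p.hi q) := hpr (p.lo_rel_hi q)
        by_cases hx : r.rel (p.lo q) x
        · have hy := r.rel.trans hx hxy
          obtain ⟨a, b, hab, hx⟩ := h (Quotient.mk _ (p.lo q))
          have ha : p.lo q = a.1 := le_antisymm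
            (mem_bases.1 hq _ (r.rel.symm (Quotient.exact a.2))) (hx ⟨p.lo q, rfl⟩).1
          refine ⟨mem_bases.1 hq _ hy, le_trans (hx ⟨y, Quotient.sound (r.rel.symm hy)⟩).2
            (p.le_hi ?_)⟩
          have hba : Quotient.mk p.rel b.1 = Quotient.mk p.rel a.1 :=
            Quotient.sound (p.rel.symm hab)
          exact hba.trans ((congrArg _ ha).symm.trans (p.mk_lo q))
        · have h1 : p.lo q < x := lt_of_le_of_ne hqx.1 fun h => hx (by rw [← h])
          have h2 : x < p.hi q := lt_of_le_of_ne hqx.2 fun h => hx (by rwa [h])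
          by_contra hcon
          rw [not_and_or, not_le, not_le] at hcon
          apply hx
          rcases hcon with h | h
          · have := r.nc y x (p.lo q) (p.hi q) h h1 h2 (r.rel.symm hxy) hhi
            exact r.rel.symm (r.rel.trans hxy this)
          · exact r.nc (p.lo q) (p.hi q) x y h1 h2 h hhi hxy
      exact fun q hq => ⟨key x y hxy q hq, key y x (r.rel.symm hxy) q hq⟩

end NCRel

open NCRel

/-! ### The two alternating convolution identities -/

theorem neg_one_pow_mul_self (n : ℕ) : (-1 : K) ^ n * (-1) ^ n = 1 := by
  rw [← mul_pow]; simp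

/-- The contributing `r` are those encoded by hulls, with sign `(-1)^(k(p) + k(r))`. If `p` is
convex the hulls are disjoint and only one term survives; otherwise some block meets the hull of
another one and the sum cancels. -/
theorem NCRel.cv_one_signed_irrInd_std {α : Type*} [LinearOrder α] [Fintype α] [Nonempty α]
    (p : NCRel α) : cv (fun _ => 1) (signed (irrInd K)) p.std = boolInd K p.std := by
  have h1 : cv (fun _ => 1) (signed (irrInd K)) p.std =
      (-1) ^ Fintype.card (Quotient p.rel) *
      ∑ r ∈ Finset.univ.filter (fun r => p ≤ r ∧
        p.isNesting_hull.Encodes r), (-1 : K) ^ Fintype.card (Quotient r.rel) := by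
    rw [cv_std, Finset.mul_sum, ← Finset.filter_filter]
    conv_rhs => rw [Finset.sum_filter]
    refine Finset.sum_congr rfl fun r hr => ?_
    have hpr : p ≤ r := (Finset.mem_filter.1 hr).2
    simp only [signed]
    rw [Finset.prod_mul_distrib, prod_sign hpr, one_mul]
    simp only [encodes_iff_isEnclosed hpr]
    split_ifs with h
    · rw [Finset.prod_eq_one, mul_one, pow_add]
      intro τ _
      rw [irrInd, atBlock, if_pos ((isIrreducible_std _).2 (h τ))]
    · push Not at h
      obtain ⟨τ, hτ⟩ := h
      rw [Finset.prod_eq_zero (Finset.mem_univ τ), mul_zero]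
      rw [irrInd, atBlock, if_neg]
      rwa [isIrreducible_std]
  rw [h1, p.isNesting_hull.sum_sign_eq_sum_bases, boolInd]
  split_ifs with h
  · rw [isBoolean_std] at h
    rw [p.isNesting_hull.sum_bases_eq_one, neg_one_pow_mul_self]
    rintro q₀ q₁ ⟨h2, h3⟩
    have := h _ _ _ h2 h3 (p.lo_rel_hi q₁)
    rw [← p.mk_lo q₀, ← p.mk_lo q₁]
    exact Quotient.sound (p.rel.symm this)
  · rw [isBoolean_std] at h
    simp only [IsConvex] at h
    push Not at h
    obtain ⟨a, x, b, hax, hxb, hab, hn⟩ := h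
    rw [p.isNesting_hull.sum_bases_eq_zero (q₀ := Quotient.mk _ x) (q₁ := Quotient.mk _ a), mul_zero]
    · intro h
      exact hn (p.rel.symm (Quotient.exact h))
    · refine p.isNesting_hull.rel _ x _ (Quotient.exact (p.mk_lo _).symm) ⟨?_, ?_⟩
      · exact (p.lo_le rfl).trans hax
      · exact hxb.trans (p.le_hi (Quotient.sound (p.rel.symm hab)))

theorem cv_one_signed_irrInd : cv (fun _ => 1) (signed (irrInd K)) = boolInd K := by
  funext P
  rw [← std_ofPart P]
  exact NCRel.cv_one_signed_irrInd_std _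

/-- For convex `p` the contributing `r` are the convex coarsenings, encoded by rays. Any two rays
are comparable, so the sum cancels as soon as there are two blocks. For other `p` no term survives:
if `r` and all restrictions of `p` to its blocks were convex, so would be `p`. -/
theorem NCRel.cv_signed_boolInd_boolInd_std {α : Type*} [LinearOrder α] [Fintype α] [Nonempty α]
    (p : NCRel α) : cv (signed (boolInd K)) (boolInd K) p.std = cvOne p.std := by
  by_cases hp : p.IsConvex
  · have h1 : cv (signed (boolInd K)) (boolInd K) p.std =
        - ∑ r ∈ Finset.univ.filter (fun r => p ≤ r ∧ hp.isNesting.Encodes r),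
          (-1 : K) ^ Fintype.card (Quotient r.rel) := by
      rw [cv_std, ← Finset.sum_neg_distrib, ← Finset.filter_filter]
      conv_rhs => rw [Finset.sum_filter]
      refine Finset.sum_congr rfl fun r hr => ?_
      have hpr : p ≤ r := (Finset.mem_filter.1 hr).2
      simp only [hp.encodes_iff hpr, signed, numBlocks_std, boolInd, isBoolean_std]
      split_ifs with h
      · rw [Finset.prod_eq_one, pow_succ]
        · ring
        intro τ _
        rw [if_pos]
        rw [atBlock, isBoolean_std]
        exact fun a x b hax hxb hab => hp a x b hax hxb hab
      · simp
    rw [h1, hp.isNesting.sum_sign_eq_sum_bases, cvOne]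
    split_ifs with h <;> rw [numBlocks_std_eq_one_iff] at h
    · rw [hp.isNesting.sum_bases_eq_one]
      · rw [(numBlocks_std p).symm, (numBlocks_std_eq_one_iff p).2 h]
        simp
      · intro q₀ q₁ _
        rw [← p.mk_lo q₀, ← p.mk_lo q₁]
        exact Quotient.sound (h _ _)
    · push Not at h
      obtain ⟨a, b, hab⟩ := h
      have hne : Quotient.mk p.rel a ≠ Quotient.mk p.rel b := fun h => hab (Quotient.exact h)
      rcases le_total (p.lo (Quotient.mk _ a)) (p.lo (Quotient.mk _ b)) with h | h
      · rw [hp.isNesting.sum_bases_eq_zero hne.symm h, neg_zero]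
      · rw [hp.isNesting.sum_bases_eq_zero hne h, neg_zero]
  · have h1 : ¬ ∀ a b, p.rel a b := fun h => hp fun a x _ _ _ _ => h a x
    rw [cvOne, if_neg (by rwa [numBlocks_std_eq_one_iff]), cv_std]
    refine Finset.sum_eq_zero fun r hr => ?_
    have hpr : p ≤ r := (Finset.mem_filter.1 hr).2
    by_contra hn
    have hr : r.IsConvex := by
      rw [← isBoolean_std]
      by_contra hb
      rw [signed, boolInd, if_neg hb, mul_zero, zero_mul] at hn
      exact hn rfl
    apply hp
    intro a x b hax hxb hab
    have hb : (p.res fun x => Quotient.mk r.rel x = Quotient.mk r.rel a).IsConvex := by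
      rw [← isBoolean_std]
      by_contra hb
      rw [Finset.prod_eq_zero (Finset.mem_univ (Quotient.mk r.rel a)), mul_zero] at hn
      · exact hn rfl
      · rw [boolInd, atBlock, if_neg hb]
    exact hb ⟨a, rfl⟩ ⟨x, Quotient.sound (r.rel.symm (hr a x b hax hxb (hpr hab)))⟩
      ⟨b, Quotient.sound (r.rel.symm (hpr hab))⟩ hax hxb hab

theorem cv_signed_boolInd_boolInd : cv (signed (boolInd K)) (boolInd K) = cvOne := by
  funext P
  rw [← std_ofPart P]
  exact NCRel.cv_signed_boolInd_boolInd_std _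

/-! ## Half-shuffle exponentials -/

namespace HGap

variable (K) in
/-- The monomial `P₁ ⋯ P_r`. -/
def word (w : List NCP) : HGap K := (w.map (FreeAlgebra.ι K)).prod

@[simp] theorem word_nil : word K [] = 1 := rfl

@[simp] theorem word_cons (P : NCP) (w : List NCP) :
    word K (P :: w) = FreeAlgebra.ι K P * word K w := by simp [word]

@[simp] theorem word_append (v w : List NCP) : word K (v ++ w) = word K v * word K w := by
  simp [word]

theorem basis_eq_word (w : FreeMonoid NCP) :
    FreeAlgebra.basisFreeMonoid K NCP w = word K w.toList := by
  simp [FreeAlgebra.basisFreeMonoid, FreeAlgebra.equivMonoidAlgebraFreeMonoid, word,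
    FreeMonoid.lift_apply]

theorem hom_ext_word {M : Type*} [AddCommGroup M] [Module K M] {f g : HGap K →ₗ[K] M}
    (h : ∀ w, f (word K w) = g (word K w)) : f = g :=
  (FreeAlgebra.basisFreeMonoid K NCP).ext fun w => by simpa [basis_eq_word] using h w.toList

theorem constr_word {M : Type*} [AddCommGroup M] [Module K M] (f : List NCP → M) (w : List NCP) :
    (FreeAlgebra.basisFreeMonoid K NCP).constr K (fun w => f w.toList) (word K w) = f w := by
  have := (FreeAlgebra.basisFreeMonoid K NCP).constr_basis K (fun w => f w.toList)
    (FreeMonoid.ofList w)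
  rwa [basis_eq_word] at this

theorem Δleft_word (w : List NCP) : Δleft K (word K w) = ΔleftWord K w := constr_word _ _

theorem Δright_word (w : List NCP) : Δright K (word K w) = ΔrightWord K w := constr_word _ _

@[simp] theorem ε_ι (P : NCP) : ε K (FreeAlgebra.ι K P) = 0 := by simp [ε]

theorem e_word (w : List NCP) : e K (word K w) =
    match w with
    | [P] => if P.numBlocks = 1 then (1 : K) else 0
    | _ => 0 := by
  have h : word K w = FreeAlgebra.basisFreeMonoid K NCP (FreeMonoid.ofList w) :=
    (basis_eq_word _).symm
  rw [h, e, Module.Basis.constr_basis]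
  rfl

theorem e_ι (P : NCP) : e K (FreeAlgebra.ι K P) = if P.numBlocks = 1 then 1 else 0 := by
  have := e_word (K := K) [P]
  simpa using this

theorem e_ι_mul (P : NCP) (x : HGap K) :
    e K (FreeAlgebra.ι K P * x) = e K (FreeAlgebra.ι K P) * ε K x := by
  have : e K ∘ₗ LinearMap.mulLeft K (FreeAlgebra.ι K P) =
      e K (FreeAlgebra.ι K P) • (ε K).toLinearMap := by
    refine hom_ext_word fun w => ?_
    cases w with
    | nil => simp
    | cons Q w =>
      have := e_word (K := K) (P :: Q :: w)
      simpa using this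
  simpa using LinearMap.congr_fun this x

/-- The contraction of the left-hand factor by the counit. -/
def εleft : HGap K ⊗[K] HGap K →ₐ[K] HGap K :=
  (Algebra.TensorProduct.lid K (HGap K)).toAlgHom.comp
    (Algebra.TensorProduct.map (ε K) (AlgHom.id K (HGap K)))

/-- The contraction of the right-hand factor by the counit. -/
def εright : HGap K ⊗[K] HGap K →ₐ[K] HGap K :=
  (Algebra.TensorProduct.rid K K (HGap K)).toAlgHom.comp
    (Algebra.TensorProduct.map (AlgHom.id K (HGap K)) (ε K))

@[simp] theorem εleft_tmul (x y : HGap K) : εleft (x ⊗ₜ[K] y) = ε K x • y := by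
  simp [εleft]

@[simp] theorem εright_tmul (x y : HGap K) : εright (x ⊗ₜ[K] y) = ε K y • x := by
  simp [εright]

/-- As `e (P * x) = e P * ε x`, the rest of the left factor is contracted by the counit. With
`εleft_Δ`, only the cut of the first letter matters and later letters pass unchanged to the right.
-/
theorem leftShuffle_aux (φ : Module.Dual K (HGap K)) (P : NCP) (g : HGap K)
    (b : HGap K ⊗[K] HGap K) :
    LinearMap.mul' K K (TensorProduct.map (e K) φ ((FreeAlgebra.ι K P ⊗ₜ[K] g) * b)) =
      e K (FreeAlgebra.ι K P) * φ (g * εleft b) := by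
  induction b with
  | zero => simp
  | tmul x y => simp [e_ι_mul, mul_assoc]
  | add x y hx hy => rw [mul_add, map_add, map_add, hx, hy, map_add, mul_add, map_add, mul_add]

theorem rightShuffle_aux (φ : Module.Dual K (HGap K)) (P : NCP) (l g : HGap K)
    (b : HGap K ⊗[K] HGap K) :
    LinearMap.mul' K K (TensorProduct.map φ (e K) ((l ⊗ₜ[K] (FreeAlgebra.ι K P * g)) * b)) =
      e K (FreeAlgebra.ι K P * g) * φ (l * εright b) := by
  induction b with
  | zero => simp
  | tmul x y =>
    simp [e_ι_mul, mul_assoc]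
    ring
  | add x y hx hy => rw [mul_add, map_add, map_add, hx, hy, map_add, mul_add, map_add, mul_add]

/-! ### Gaps -/

theorem restrict_univ (P : NCP) (h : (Finset.univ : Finset (Fin P.deg)).Nonempty) :
    P.restrict Finset.univ h = P :=
  NCP.eq_of_orderIso _ _ ((Finset.univ.orderIsoOfFin rfl).trans
    ⟨Equiv.subtypeUnivEquiv fun x => Finset.mem_univ x, Iff.rfl⟩) fun _ _ => Iff.rfl

theorem ofRestrict_univ (P : NCP) : ofRestrict K P Finset.univ = FreeAlgebra.ι K P := by
  have h : (Finset.univ : Finset (Fin P.deg)).Nonempty := ⟨P.first, Finset.mem_univ _⟩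
  rw [ofRestrict, dif_pos h, restrict_univ]

@[simp] theorem ofRestrict_empty (P : NCP) : ofRestrict K P ∅ = 1 := by simp [ofRestrict]

theorem ε_ofRestrict (P : NCP) (X : Finset (Fin P.deg)) :
    ε K (ofRestrict K P X) = if X.Nonempty then 0 else 1 := by
  unfold ofRestrict
  split_ifs <;> simp

theorem mem_gap {n : ℕ} {L : Finset (Fin n)} {i : ℕ} {y : Fin n} :
    y ∈ NCPart.gap L i ↔ y ∉ L ∧ (L.filter (· < y)).card = i := by simp [NCPart.gap]

theorem gapMonomial_univ (P : NCP) : gapMonomial K P Finset.univ = FreeAlgebra.ι K P := by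
  have : NCPart.gap (∅ : Finset (Fin P.deg)) 0 = Finset.univ := by
    ext y; simp [mem_gap]
  simp [gapMonomial, this, ofRestrict_univ]

theorem gapMonomial_empty (P : NCP) : gapMonomial K P ∅ = 1 := by
  have : ∀ i, NCPart.gap (Finset.univ : Finset (Fin P.deg)) i = ∅ := by
    intro i; ext y; simp [mem_gap]
  simp [gapMonomial, this]

theorem ε_gapMonomial (P : NCP) {U : Finset (Fin P.deg)} (hU : U.Nonempty) :
    ε K (gapMonomial K P U) = 0 := by
  obtain ⟨y, hy⟩ := hU
  rw [gapMonomial, map_list_prod]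
  refine List.prod_eq_zero ?_
  simp only [List.map_map, List.mem_map, List.mem_range, Function.comp]
  refine ⟨(Uᶜ.filter (· < y)).card, ?_, ?_⟩
  · exact Nat.lt_succ_of_le (Finset.card_filter_le _ _)
  · rw [ε_ofRestrict, if_pos ⟨y, mem_gap.2 ⟨by simpa using hy, rfl⟩⟩]

theorem isUpperset_univ {n : ℕ} (P : NCPart n) : P.IsUpperset Finset.univ :=
  ⟨fun _ _ _ _ => Finset.mem_univ _, fun _ _ _ _ _ _ _ => Finset.mem_univ _⟩

theorem isUpperset_empty {n : ℕ} (P : NCPart n) : P.IsUpperset ∅ :=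
  ⟨fun _ _ _ h => absurd h (Finset.notMem_empty _),
    fun _ _ _ h => absurd h (Finset.notMem_empty _)⟩

theorem εleft_Δ (x : HGap K) : εleft (Δ K x) = x := by
  have : εleft.comp (Δ K) = AlgHom.id K (HGap K) := by
    refine FreeAlgebra.hom_ext ?_
    funext P
    simp only [Δ, Function.comp_apply, AlgHom.comp_apply, FreeAlgebra.lift_ι_apply, map_sum,
      cutTerm, εleft_tmul, AlgHom.id_apply]
    rw [Finset.sum_eq_single Finset.univ]
    · simp [gapMonomial_univ]
    · intro U _ hU
      rw [ε_ofRestrict, if_pos, zero_smul]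
      rwa [Finset.nonempty_iff_ne_empty, Ne, Finset.compl_eq_empty_iff]
    · intro h
      exact absurd (Finset.mem_filter.2 ⟨Finset.mem_univ _, isUpperset_univ _⟩) h
  exact DFunLike.congr_fun this x

theorem εright_Δ (x : HGap K) : εright (Δ K x) = x := by
  have : εright.comp (Δ K) = AlgHom.id K (HGap K) := by
    refine FreeAlgebra.hom_ext ?_
    funext P
    simp only [Δ, Function.comp_apply, AlgHom.comp_apply, FreeAlgebra.lift_ι_apply, map_sum,
      cutTerm, εright_tmul, AlgHom.id_apply]
    rw [Finset.sum_eq_single ∅]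
    · simp [gapMonomial_empty, ofRestrict_univ]
    · intro U _ hU
      rw [ε_gapMonomial P (Finset.nonempty_iff_ne_empty.2 hU), zero_smul]
    · intro h
      exact absurd (Finset.mem_filter.2 ⟨Finset.mem_univ _, isUpperset_empty _⟩) h
  exact DFunLike.congr_fun this x

theorem prod_Δ (w : List NCP) :
    (w.map fun Q => Δ K (FreeAlgebra.ι K Q)).prod = Δ K (word K w) := by
  rw [word, map_list_prod, List.map_map]
  rfl

theorem numBlocks_restrict_eq_one_iff (P : NCP) (X : Finset (Fin P.deg)) (hX : X.Nonempty) :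
    (P.restrict X hX).numBlocks = 1 ↔ ∀ a ∈ X, ∀ b ∈ X, P.part.rel a b := by
  have : Nonempty {x // x ∈ X} := hX.to_subtype
  rw [NCRel.restrict_eq_std P X hX (OrderIso.refl _) ((NCRel.ofPart P.part).res (· ∈ X))
    fun _ _ => Iff.rfl, NCRel.numBlocks_std_eq_one_iff]
  exact ⟨fun h a ha b hb => h ⟨a, ha⟩ ⟨b, hb⟩, fun h a b => h _ a.2 _ b.2⟩

/-! ### The half-shuffle equations as recursions -/

/-- The block of the first element. -/
def firstBlock (P : NCP) : Finset (Fin P.deg) :=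
  Finset.univ.filter fun x => P.part.rel P.first x

theorem mem_firstBlock {P : NCP} {x : Fin P.deg} : x ∈ firstBlock P ↔ P.part.rel P.first x := by
  simp [firstBlock]

theorem first_mem_firstBlock (P : NCP) : P.first ∈ firstBlock P :=
  mem_firstBlock.2 (P.part.rel.refl _)

theorem first_le (P : NCP) (x : Fin P.deg) : P.first ≤ x := Fin.mk_le_of_le_val (Nat.zero_le _)

theorem isUpperset_compl_firstBlock (P : NCP) : P.part.IsUpperset (firstBlock P)ᶜ := by
  constructor
  · intro a b hab ha
    rw [Finset.mem_compl, mem_firstBlock] at ha ⊢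
    exact fun hb => ha (P.part.rel.trans hb (P.part.rel.symm hab))
  · intro a b x ha hab hax hxb
    rw [Finset.mem_compl, mem_firstBlock] at ha ⊢
    intro hx
    apply ha
    rcases hax.eq_or_lt with rfl | hax
    · exact hx
    rcases hxb.eq_or_lt with rfl | hxb
    · exact P.part.rel.trans hx (P.part.rel.symm hab)
    rcases (first_le P a).eq_or_lt with h | h
    · rw [← h]
    exact P.part.nc P.first x a b h hax hxb hx hab

/-- A lowerset containing the first element on which `e` does not vanish is one block, hence the
first block. Its complement is an upperset because a block whose hull met the first block would
cross it. -/
theorem leftShuffle_word_cons (φ : Module.Dual K (HGap K)) (P : NCP) (w : List NCP) :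
    leftShuffle (e K) φ (word K (P :: w)) =
      φ (gapMonomial K P (firstBlock P)ᶜ * word K w) := by
  simp only [leftShuffle, LinearMap.comp_apply, Δleft_word, ΔleftWord]
  rw [Finset.sum_mul, map_sum, map_sum, Finset.sum_eq_single (firstBlock P)ᶜ]
  · have hne : (firstBlock P)ᶜᶜ.Nonempty := by
      rw [compl_compl]; exact ⟨_, first_mem_firstBlock P⟩
    rw [cutTerm, ofRestrict, dif_pos hne, leftShuffle_aux, prod_Δ, εleft_Δ, e_ι, if_pos, one_mul]
    rw [numBlocks_restrict_eq_one_iff]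
    simp only [compl_compl, mem_firstBlock]
    exact fun a ha b hb => P.part.rel.trans (P.part.rel.symm ha) hb
  · intro U hU hne
    obtain ⟨-, hU, hf⟩ := Finset.mem_filter.1 hU
    have hne' : Uᶜ.Nonempty := ⟨P.first, by simpa using hf⟩
    rw [cutTerm, ofRestrict, dif_pos hne', leftShuffle_aux, e_ι, if_neg, zero_mul]
    rw [numBlocks_restrict_eq_one_iff]
    intro h
    apply hne
    rw [eq_compl_comm]
    ext x
    rw [mem_firstBlock, Finset.mem_compl]
    constructor
    · exact fun h hx => hf (hU.1 _ _ (P.part.rel.symm h) hx)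
    · exact fun hx => h _ (by simpa using hf) _ (by simpa using hx)
  · intro h
    refine absurd (Finset.mem_filter.2 ⟨Finset.mem_univ _, isUpperset_compl_firstBlock P, ?_⟩) h
    rw [Finset.mem_compl, not_not]
    exact first_mem_firstBlock P

theorem gapMonomial_eq_mul (P : NCP) (U : Finset (Fin P.deg)) :
    gapMonomial K P U = ofRestrict K P (NCPart.gap Uᶜ 0) *
      ((List.range Uᶜ.card).map fun i => ofRestrict K P (NCPart.gap Uᶜ (i + 1))).prod := by
  rw [gapMonomial, List.range_succ_eq_map]
  simp [Function.comp_def]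

theorem first_mem_gap {P : NCP} {U : Finset (Fin P.deg)} (hU : P.first ∈ U) :
    P.first ∈ NCPart.gap Uᶜ 0 := by
  rw [mem_gap]
  refine ⟨by simpa using hU, ?_⟩
  rw [Finset.card_eq_zero, Finset.filter_eq_empty_iff]
  exact fun x _ => not_lt.2 (first_le P x)

/-- Gap `0` contains the first element, so its factor is not `1`. For `e` not to vanish, all other
gaps must be empty and gap `0` a single block; then `U` is the first block and an initial interval.
-/
theorem e_gapMonomial (P : NCP) {U : Finset (Fin P.deg)} (hU : P.part.IsUpperset U)
    (hf : P.first ∈ U) :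
    e K (gapMonomial K P U) =
      if U = firstBlock P ∧ ∀ x y, y ∈ firstBlock P → x ≤ y → x ∈ firstBlock P then 1 else 0 := by
  have hne : (NCPart.gap Uᶜ 0).Nonempty := ⟨_, first_mem_gap hf⟩
  rw [gapMonomial_eq_mul]
  conv_lhs => arg 2; arg 1; rw [ofRestrict, dif_pos hne]
  rw [e_ι_mul, e_ι, map_list_prod, List.map_map]
  split_ifs with h1 h2 h2
  · obtain ⟨rfl, h2⟩ := h2
    rw [one_mul, List.prod_eq_one]
    simp only [List.mem_map, Function.comp_apply]
    rintro _ ⟨i, -, rfl⟩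
    rw [ε_ofRestrict, if_neg]
    rintro ⟨y, hy⟩
    rw [mem_gap, Finset.mem_compl, not_not] at hy
    have : (Finset.filter (· < y) (firstBlock P)ᶜ) = ∅ := by
      rw [Finset.filter_eq_empty_iff]
      intro x hx hxy
      exact Finset.mem_compl.1 hx (h2 x y hy.1 hxy.le)
    rw [this] at hy
    simp at hy
  · rw [numBlocks_restrict_eq_one_iff] at h1
    rw [one_mul]
    refine List.prod_eq_zero ?_
    by_contra hcon
    apply h2
    have hsub : ∀ y ∈ U, y ∈ NCPart.gap Uᶜ 0 := by
      intro y hy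
      have hyc : y ∉ Uᶜ := by simpa using hy
      obtain ⟨i, hi⟩ : ∃ i, i = (Finset.filter (· < y) Uᶜ).card := ⟨_, rfl⟩
      cases i with
      | zero => exact mem_gap.2 ⟨hyc, hi.symm⟩
      | succ i =>
        refine absurd (List.mem_map.2 ⟨i, List.mem_range.2 ?_, ?_⟩) hcon
        · have := Finset.card_filter_le Uᶜ (· < y)
          omega
        · simp only [Function.comp_apply]
          rw [ε_ofRestrict, if_pos ⟨y, mem_gap.2 ⟨hyc, hi.symm⟩⟩]
    have hUF : U = firstBlock P := by
      ext x
      rw [mem_firstBlock]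
      exact ⟨fun hx => h1 _ (hsub _ hf) _ (hsub _ hx), fun h => hU.1 _ _ h hf⟩
    refine ⟨hUF, fun x y hy hxy => ?_⟩
    rw [← hUF] at hy ⊢
    by_contra hx
    have := (mem_gap.1 (hsub y hy)).2
    rw [Finset.card_eq_zero, Finset.filter_eq_empty_iff] at this
    refine this (Finset.mem_compl.2 hx) (lt_of_le_of_ne hxy ?_)
    rintro rfl
    exact hx hy
  · exfalso
    apply h1
    rw [numBlocks_restrict_eq_one_iff]
    have : ∀ a ∈ NCPart.gap Uᶜ 0, P.part.rel P.first a := by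
      intro a ha
      have := (mem_gap.1 ha).1
      rw [Finset.mem_compl, not_not, h2.1] at this
      exact mem_firstBlock.1 this
    exact fun a ha b hb => P.part.rel.trans (P.part.rel.symm (this a ha)) (this b hb)
  · rw [zero_mul]

theorem rightShuffle_word_cons (φ : Module.Dual K (HGap K)) (P : NCP) (w : List NCP) :
    rightShuffle φ (e K) (word K (P :: w)) =
      if ∀ x y, y ∈ firstBlock P → x ≤ y → x ∈ firstBlock P then
        φ (ofRestrict K P (firstBlock P)ᶜ * word K w) else 0 := by
  simp only [rightShuffle, LinearMap.comp_apply, Δright_word, ΔrightWord]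
  have key : ∀ U : Finset (Fin P.deg), P.part.IsUpperset U ∧ P.first ∈ U →
      LinearMap.mul' K K (TensorProduct.map φ (e K) (cutTerm K P U *
        (w.map fun Q => Δ K (FreeAlgebra.ι K Q)).prod)) =
      (if U = firstBlock P ∧ ∀ x y, y ∈ firstBlock P → x ≤ y → x ∈ firstBlock P then 1 else 0) *
        φ (ofRestrict K P Uᶜ * word K w) := by
    rintro U ⟨hU, hf⟩
    rw [← e_gapMonomial P hU hf, cutTerm, gapMonomial_eq_mul]
    have hne : (NCPart.gap Uᶜ 0).Nonempty := ⟨_, first_mem_gap hf⟩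
    have : ofRestrict K P (NCPart.gap Uᶜ 0) = FreeAlgebra.ι K (P.restrict _ hne) := by
      rw [ofRestrict, dif_pos hne]
    rw [this, rightShuffle_aux, prod_Δ, εright_Δ]
  rw [Finset.sum_mul, map_sum, map_sum,
    Finset.sum_congr rfl fun U hU => key U (Finset.mem_filter.1 hU).2]
  split_ifs with h
  · rw [Finset.sum_eq_single (firstBlock P)]
    · rw [if_pos ⟨rfl, h⟩, one_mul]
    · intro U _ hne
      rw [if_neg fun h' => hne h'.1, zero_mul]
    · intro h'
      refine absurd (Finset.mem_filter.2 ⟨Finset.mem_univ _, ⟨?_, ?_⟩, ?_⟩) h'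
      · intro a b hab ha
        rw [mem_firstBlock] at ha ⊢
        exact P.part.rel.trans ha hab
      · intro a b x ha hab _ hxb
        refine h x b ?_ hxb
        rw [mem_firstBlock] at ha ⊢
        exact P.part.rel.trans ha hab
      · exact first_mem_firstBlock P
  · refine Finset.sum_eq_zero fun U _ => ?_
    rw [if_neg fun h' => h h'.2, zero_mul]

end HGap

/-! ### Solutions of the recursions and their uniqueness -/

namespace HGap

/-- The number of elements of a multipartition. -/
def wordDeg (w : List NCP) : ℕ := (w.map NCP.deg).sum

@[simp] theorem wordDeg_cons (P : NCP) (w : List NCP) :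
    wordDeg (P :: w) = P.deg + wordDeg w := by simp [wordDeg]

@[simp] theorem wordDeg_append (v w : List NCP) : wordDeg (v ++ w) = wordDeg v + wordDeg w := by
  simp [wordDeg]

/-- Each step lowers the number of elements, so the value at `1` determines the form on all words.
-/
theorem dual_ext_of_recursion {φ φ' : Module.Dual K (HGap K)} (h1 : φ 1 = φ' 1)
    (h : ∀ P w, ∃ c : K, ∃ v, wordDeg v < wordDeg (P :: w) ∧
      φ (word K (P :: w)) = c * φ (word K v) ∧ φ' (word K (P :: w)) = c * φ' (word K v)) :
    φ = φ' := by
  have key : ∀ N, ∀ w, wordDeg w = N → φ (word K w) = φ' (word K w) := by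
    intro N
    induction N using Nat.strong_induction_on with
    | h N ih =>
      rintro (_ | ⟨P, w⟩) hw
      · exact h1
      · obtain ⟨c, v, hv, h2, h3⟩ := h P w
        rw [h2, h3, ih _ (hw ▸ hv) v rfl]
  exact hom_ext_word fun w => key _ w rfl

theorem exists_ofRestrict_eq_word (P : NCP) (X : Finset (Fin P.deg)) :
    ∃ v, ofRestrict K P X = word K v ∧ wordDeg v = X.card := by
  by_cases hX : X.Nonempty
  · exact ⟨[P.restrict X hX], by simp [ofRestrict, hX], by simp [wordDeg, NCP.restrict]⟩
  · exact ⟨[], by simp [ofRestrict, hX], by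
      simp [wordDeg, Finset.not_nonempty_iff_eq_empty.1 hX]⟩

theorem exists_gapMonomial_eq_word (P : NCP) (U : Finset (Fin P.deg)) :
    ∃ v, gapMonomial K P U = word K v ∧ wordDeg v = U.card := by
  choose f hf hdeg using fun i => exists_ofRestrict_eq_word (K := K) P (NCPart.gap Uᶜ i)
  have key : ∀ l : List ℕ, (l.map fun i => ofRestrict K P (NCPart.gap Uᶜ i)).prod =
      word K (l.flatMap f) ∧
      wordDeg (l.flatMap f) = (l.map fun i => (NCPart.gap Uᶜ i).card).sum := by
    intro l
    induction l with
    | nil => exact ⟨rfl, rfl⟩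
    | cons i l ih =>
      rw [List.map_cons, List.prod_cons, ih.1, List.flatMap_cons, word_append, wordDeg_append,
        ih.2, hf, hdeg, List.map_cons, List.sum_cons]
      exact ⟨rfl, rfl⟩
  refine ⟨_, (key _).1, (key _).2.trans ?_⟩
  -- The gaps partition `U`: each point is sorted by the number of points of the complement below
  -- it.
  rw [Finset.card_eq_sum_card_fiberwise (s := U) (f := fun y => (Uᶜ.filter (· < y)).card)
    (t := Finset.range (Uᶜ.card + 1))]
  · have hsum : ∀ (g : ℕ → ℕ) (n : ℕ),
        ((List.range n).map g).sum = ∑ i ∈ Finset.range n, g i := by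
      intro g n
      induction n with
      | zero => rfl
      | succ n ih => simp [List.range_succ, Finset.sum_range_succ, ih]
    rw [hsum]
    refine Finset.sum_congr rfl fun i _ => congrArg Finset.card ?_
    ext y
    simp [mem_gap]
  · intro y _
    simpa using Nat.lt_succ_of_le (Finset.card_filter_le _ _)

theorem card_compl_firstBlock_lt (P : NCP) : (firstBlock P)ᶜ.card < P.deg := by
  have h := Finset.card_compl_add_card (firstBlock P)
  have := Finset.card_pos.2 ⟨_, first_mem_firstBlock P⟩
  rw [Fintype.card_fin] at h
  omega

theorem leftShuffle_one (κ φ : Module.Dual K (HGap K)) : leftShuffle κ φ 1 = 0 := by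
  rw [← word_nil, leftShuffle, LinearMap.comp_apply, LinearMap.comp_apply, Δleft_word]
  simp [ΔleftWord]

theorem rightShuffle_one (κ φ : Module.Dual K (HGap K)) : rightShuffle φ κ 1 = 0 := by
  rw [← word_nil, rightShuffle, LinearMap.comp_apply, LinearMap.comp_apply, Δright_word]
  simp [ΔrightWord]

theorem isLeftExp_e_iff (φ : Module.Dual K (HGap K)) :
    IsLeftExp (e K) φ ↔ φ 1 = 1 ∧ ∀ P w, φ (word K (P :: w)) =
      φ (gapMonomial K P (firstBlock P)ᶜ * word K w) := by
  constructor
  · intro h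
    refine ⟨?_, fun P w => ?_⟩
    · have := LinearMap.congr_fun h 1
      simpa [leftShuffle_one] using this
    · have := LinearMap.congr_fun h (word K (P :: w))
      rw [LinearMap.add_apply, leftShuffle_word_cons] at this
      simpa using this
  · rintro ⟨h1, h2⟩
    refine hom_ext_word fun w => ?_
    cases w with
    | nil => simp [leftShuffle_one, h1]
    | cons P w =>
      rw [LinearMap.add_apply, leftShuffle_word_cons, ← h2]
      simp

theorem isRightExp_e_iff (φ : Module.Dual K (HGap K)) :
    IsRightExp (e K) φ ↔ φ 1 = 1 ∧ ∀ P w, φ (word K (P :: w)) =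
      if ∀ x y, y ∈ firstBlock P → x ≤ y → x ∈ firstBlock P then
        φ (ofRestrict K P (firstBlock P)ᶜ * word K w) else 0 := by
  constructor
  · intro h
    refine ⟨?_, fun P w => ?_⟩
    · have := LinearMap.congr_fun h 1
      simpa [rightShuffle_one] using this
    · have := LinearMap.congr_fun h (word K (P :: w))
      rw [LinearMap.add_apply, rightShuffle_word_cons] at this
      simpa using this
  · rintro ⟨h1, h2⟩
    refine hom_ext_word fun w => ?_
    cases w with
    | nil => simp [rightShuffle_one, h1]
    | cons P w =>
      rw [LinearMap.add_apply, rightShuffle_word_cons, ← h2]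
      simp

variable (K) in
/-- The left half-shuffle exponential of `e`: all partitions have value `1`. -/
def leftExp : HGap K →ₐ[K] K := FreeAlgebra.lift K fun _ => 1

variable (K) in
/-- The right half-shuffle exponential of `e`: the indicator function of boolean partitions. -/
def rightExp : HGap K →ₐ[K] K := FreeAlgebra.lift K (boolInd K)

theorem leftExp_word (w : List NCP) : leftExp K (word K w) = 1 := by
  induction w with
  | nil => simp
  | cons P w ih =>
    rw [word_cons, map_mul, ih, leftExp, FreeAlgebra.lift_ι_apply, mul_one]

theorem isLeftExp_leftExp : IsLeftExp (e K) (leftExp K).toLinearMap := by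
  rw [isLeftExp_e_iff]
  refine ⟨map_one (leftExp K), fun P w => ?_⟩
  obtain ⟨v, hv, -⟩ := exists_gapMonomial_eq_word (K := K) P (firstBlock P)ᶜ
  rw [hv, ← word_append]
  exact (leftExp_word _).trans (leftExp_word _).symm

/-- The recursion of `ψ_≻` on one letter: all blocks are intervals exactly when the first block is
an initial interval and what follows it has only interval blocks. -/
theorem boolInd_eq (P : NCP) : boolInd K P =
    if ∀ x y, y ∈ firstBlock P → x ≤ y → x ∈ firstBlock P then
      rightExp K (ofRestrict K P (firstBlock P)ᶜ) else 0 := by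
  rw [boolInd]
  have hres : ∀ h : (firstBlock P)ᶜ.Nonempty, (P.restrict _ h).IsBoolean ↔
      ((NCRel.ofPart P.part).res (· ∈ (firstBlock P)ᶜ)).IsConvex := by
    intro h
    have : Nonempty {x // x ∈ (firstBlock P)ᶜ} := h.to_subtype
    rw [NCRel.restrict_eq_std P _ h (OrderIso.refl _)
      ((NCRel.ofPart P.part).res (· ∈ (firstBlock P)ᶜ)) fun _ _ => Iff.rfl, NCRel.isBoolean_std]
  rw [NCP.isBoolean_iff]
  split_ifs with h1 h2 h2
  · rw [ofRestrict]
    split_ifs with h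
    · rw [rightExp, FreeAlgebra.lift_ι_apply, boolInd, if_pos]
      rw [hres]
      exact fun a x b hax hxb hab => h1 a x b hax hxb hab
    · rw [map_one]
  · refine absurd (fun x y hy hxy => ?_) h2
    rw [mem_firstBlock] at hy ⊢
    exact h1 P.first x y (first_le P x) hxy hy
  · rw [ofRestrict]
    by_cases hcon : ∃ h : (firstBlock P)ᶜ.Nonempty, (P.restrict _ h).IsBoolean
    swap
    -- If the first block were everything, `P` would have one block and be convex.
    · have hne : (firstBlock P)ᶜ.Nonempty := by
        by_contra hne
        rw [Finset.not_nonempty_iff_eq_empty, Finset.compl_eq_empty_iff] at hne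
        apply h1
        intro a x b _ _ _
        have : ∀ x, P.part.rel P.first x := fun x => by
          rw [← mem_firstBlock, hne]; exact Finset.mem_univ x
        exact P.part.rel.trans (P.part.rel.symm (this a)) (this x)
      rw [dif_pos hne, rightExp, FreeAlgebra.lift_ι_apply, boolInd, if_neg fun h => hcon ⟨hne, h⟩]
    · exfalso
      obtain ⟨hne, hb⟩ := hcon
      rw [hres] at hb
      apply h1
      intro a x b hax hxb hab
      by_cases ha : P.part.rel P.first a
      · have hx := h2 x b (mem_firstBlock.2 (P.part.rel.trans ha hab)) hxb
        exact P.part.rel.trans (P.part.rel.symm ha) (mem_firstBlock.1 hx)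
      · have hb' : ¬ P.part.rel P.first b := fun h =>
          ha (P.part.rel.trans h (P.part.rel.symm hab))
        have hx : ¬ P.part.rel P.first x := fun h =>
          ha (mem_firstBlock.1 (h2 a x (mem_firstBlock.2 h) hax))
        rw [← mem_firstBlock, ← Finset.mem_compl] at ha hb' hx
        exact hb ⟨a, ha⟩ ⟨x, hx⟩ ⟨b, hb'⟩ hax hxb hab
  · rfl

theorem isRightExp_rightExp : IsRightExp (e K) (rightExp K).toLinearMap := by
  rw [isRightExp_e_iff]
  refine ⟨map_one (rightExp K), fun P w => ?_⟩
  have h : rightExp K (FreeAlgebra.ι K P) = boolInd K P := by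
    rw [rightExp, FreeAlgebra.lift_ι_apply]
  simp only [AlgHom.toLinearMap_apply, word_cons, map_mul]
  rw [h, boolInd_eq]
  split_ifs <;> simp

theorem isLeftExp_e_iff_eq (φ : Module.Dual K (HGap K)) :
    IsLeftExp (e K) φ ↔ φ = (leftExp K).toLinearMap := by
  constructor
  · intro h
    have h' := isLeftExp_leftExp (K := K)
    rw [isLeftExp_e_iff] at h h'
    refine dual_ext_of_recursion (h.1.trans h'.1.symm) fun P w => ?_
    obtain ⟨v, hv, hdeg⟩ := exists_gapMonomial_eq_word (K := K) P (firstBlock P)ᶜ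
    refine ⟨1, v ++ w, ?_, ?_, ?_⟩
    · rw [wordDeg_append, wordDeg_cons, hdeg]
      have := card_compl_firstBlock_lt P
      omega
    · rw [h.2, hv, word_append, one_mul]
    · rw [h'.2, hv, word_append, one_mul]
  · rintro rfl
    exact isLeftExp_leftExp

theorem isRightExp_e_iff_eq (φ : Module.Dual K (HGap K)) :
    IsRightExp (e K) φ ↔ φ = (rightExp K).toLinearMap := by
  constructor
  · intro h
    have h' := isRightExp_rightExp (K := K)
    rw [isRightExp_e_iff] at h h'
    refine dual_ext_of_recursion (h.1.trans h'.1.symm) fun P w => ?_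
    obtain ⟨v, hv, hdeg⟩ := exists_ofRestrict_eq_word (K := K) P (firstBlock P)ᶜ
    refine ⟨if ∀ x y, y ∈ firstBlock P → x ≤ y → x ∈ firstBlock P then 1 else 0,
      v ++ w, ?_, ?_, ?_⟩
    · rw [wordDeg_append, wordDeg_cons, hdeg]
      have := card_compl_firstBlock_lt P
      omega
    · rw [h.2, hv, word_append]
      split_ifs <;> simp
    · rw [h'.2, hv, word_append]
      split_ifs <;> simp
  · rintro rfl
    exact isRightExp_rightExp

end HGap

/-! ## Inverses of characters -/

namespace BBlock

/-- The restriction of a character of `B` to `NCP`. -/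
def values (φ : BBlock K →ₐ[K] K) (P : NCP) : K := φ (MvPolynomial.X P)

/-- The character of `B` with given values on `NCP`. -/
def ofValues (f : NCP → K) : BBlock K →ₐ[K] K := MvPolynomial.aeval f

@[simp] theorem values_ofValues (f : NCP → K) : values (ofValues f) = f := by
  funext P
  simp [values, ofValues]

theorem values_injective : Function.Injective (values (K := K)) := fun _ _ h =>
  MvPolynomial.algHom_ext fun P => congrFun h P

theorem values_conv (φ ψ : BBlock K →ₐ[K] K) :
    values (conv φ ψ) = cv (values φ) (values ψ) := by
  funext P
  exact conv_X φ ψ P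

theorem values_ε : values (ε K) = cvOne := by
  funext P
  simp [values, ε, cvOne]

theorem values_ofHGap (ψ : HGap K →ₐ[K] K) :
    values (ofHGap ψ) = fun P => ψ (FreeAlgebra.ι K P) := by
  funext P
  simp [values, ofHGap]

/-- Uniqueness is the monoid argument `χ = (g * φ) * χ = g * (φ * χ) = g`. -/
theorem isConvInverse_iff_eq {φ : BBlock K →ₐ[K] K} {g : NCP → K}
    (h1 : cv (values φ) g = cvOne) (h2 : cv g (values φ) = cvOne) (χ : BBlock K →ₐ[K] K) :
    IsConvInverse φ χ ↔ χ = ofValues g := by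
  constructor
  · rintro ⟨h, -⟩
    apply values_injective
    rw [values_ofValues, ← cvOne_cv (values χ), ← h2, cv_assoc, ← values_conv, h, values_ε,
      cv_cvOne]
  · rintro rfl
    constructor <;> apply values_injective <;> rw [values_conv, values_ofValues, values_ε]
    · exact h1
    · exact h2

end BBlock

/-! ### Formal consequences in the convolution monoid -/

theorem cv_boolInd_signed_boolInd : cv (boolInd K) (signed (boolInd K)) = cvOne := by
  have := congrArg signed (cv_signed_boolInd_boolInd (K := K))
  rwa [signed_cv, signed_signed, signed_cvOne] at this

theorem cv_signed_boolInd_one : cv (signed (boolInd K)) (fun _ => 1) = irrInd K := by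
  rw [← cv_boolInd_irrInd, ← cv_assoc, cv_signed_boolInd_boolInd, cvOne_cv]

/-- Writes `i = b⁻¹ * 1` and uses `1 * s i = b`. Applying `s` then gives the inverse on the other
side. -/
theorem cv_irrInd_signed_irrInd : cv (irrInd K) (signed (irrInd K)) = cvOne := by
  rw [← cv_signed_boolInd_one, cv_assoc, cv_signed_boolInd_one, cv_one_signed_irrInd,
    cv_signed_boolInd_boolInd]

theorem cv_signed_irrInd_irrInd : cv (signed (irrInd K)) (irrInd K) = cvOne := by
  have := congrArg signed (cv_irrInd_signed_irrInd (K := K))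
  rwa [signed_cv, signed_signed, signed_cvOne] at this

variable (K) in
/-- The inverse of the constant function `1`. -/
def oneInv : NCP → K := cv (signed (irrInd K)) (signed (boolInd K))

theorem cv_one_oneInv : cv (fun _ => 1) (oneInv K) = cvOne := by
  rw [oneInv, ← cv_assoc, cv_one_signed_irrInd, cv_boolInd_signed_boolInd]

theorem cv_oneInv_one : cv (oneInv K) (fun _ => 1) = cvOne := by
  rw [oneInv, cv_assoc, cv_signed_boolInd_one, cv_signed_irrInd_irrInd]

theorem cv_oneInv_boolInd : cv (oneInv K) (boolInd K) = signed (irrInd K) := by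
  rw [oneInv, cv_assoc, cv_signed_boolInd_boolInd, cv_cvOne]

theorem values_leftExp : BBlock.values (BBlock.ofHGap (HGap.leftExp K)) = fun _ => 1 := by
  rw [BBlock.values_ofHGap]
  simp [HGap.leftExp]

theorem values_rightExp : BBlock.values (BBlock.ofHGap (HGap.rightExp K)) = boolInd K := by
  rw [BBlock.values_ofHGap]
  simp [HGap.rightExp]

end

theorem mainTheorem7 (K : Type*) [Field K] :
    ∃ ψl ψr : HGap K →ₐ[K] K,
      -- `ψl` and `ψr` are the left and the right half-shuffle exponential of `e`
      (∀ φ : Module.Dual K (HGap K), HGap.IsLeftExp (HGap.e K) φ ↔ φ = ψl.toLinearMap) ∧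
      (∀ φ : Module.Dual K (HGap K), HGap.IsRightExp (HGap.e K) φ ↔ φ = ψr.toLinearMap) ∧
      ∃ ψlInv ψrInv : BBlock K →ₐ[K] K,
        -- they have unique inverses for the convolution of characters
        (∀ χ : BBlock K →ₐ[K] K, BBlock.IsConvInverse (BBlock.ofHGap ψl) χ ↔ χ = ψlInv) ∧
        (∀ χ : BBlock K →ₐ[K] K, BBlock.IsConvInverse (BBlock.ofHGap ψr) χ ↔ χ = ψrInv) ∧
        ∀ P : NCP,
          ψrInv (MvPolynomial.X P) =
            (if P.IsBoolean then (-1 : K) ^ (P.numBlocks + 1) else 0) ∧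
          BBlock.conv ψrInv (BBlock.ofHGap ψl) (MvPolynomial.X P) =
            (if P.IsIrreducible then 1 else 0) ∧
          BBlock.conv ψlInv (BBlock.ofHGap ψr) (MvPolynomial.X P) =
            (if P.IsIrreducible then (-1 : K) ^ (P.numBlocks + 1) else 0) := by
  refine ⟨HGap.leftExp K, HGap.rightExp K, HGap.isLeftExp_e_iff_eq, HGap.isRightExp_e_iff_eq,
    BBlock.ofValues (oneInv K), BBlock.ofValues (signed (boolInd K)),
    BBlock.isConvInverse_iff_eq ?_ ?_, BBlock.isConvInverse_iff_eq ?_ ?_, fun P => ⟨?_, ?_, ?_⟩⟩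
  · rw [values_leftExp, cv_one_oneInv]
  · rw [values_leftExp, cv_oneInv_one]
  · rw [values_rightExp, cv_boolInd_signed_boolInd]
  · rw [values_rightExp, cv_signed_boolInd_boolInd]
  · have h := congrFun (BBlock.values_ofValues (signed (boolInd K))) P
    refine h.trans ?_
    rw [signed, boolInd, mul_ite, mul_one, mul_zero]
  · have h := congrFun (BBlock.values_conv (BBlock.ofValues (signed (boolInd K)))
      (BBlock.ofHGap (HGap.leftExp K))) P
    rw [BBlock.values_ofValues, values_leftExp, cv_signed_boolInd_one] at h
    exact h
  · have h := congrFun (BBlock.values_conv (BBlock.ofValues (oneInv K))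
      (BBlock.ofHGap (HGap.rightExp K))) P
    rw [BBlock.values_ofValues, values_rightExp, cv_oneInv_boolInd] at h
    refine h.trans ?_
    rw [signed, irrInd, mul_ite, mul_one, mul_zero]
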